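/- Let $L\ge 1$ and $\alpha\ge 2$ be integers, let $m_1,m_2,\Omega,\beta>0$ be real, and put $$\overline\gamma=\Omega^2\beta,\qquad \tilde\gamma=\frac{m_1m_2}{\overline\gamma},\qquad \mathcal S_2=\frac1{\Gamma(m_1)\Gamma(m_2)\Gamma(\alpha)}$$ (in the normalization $\Omega=1$, $\overline\gamma$ is just the scale $\beta$). For $i=1,\dots,L$ let $N_{i,1},N_{i,2}$ be (multipath) random variables such that $N_{i,j}^2$ has the gamma density $$\frac{m_j^{m_j}x^{m_j-1}}{\Omega^{m_j}\Gamma(m_j)}e^{-m_jx/\Omega},\qquad x>0,$$ and let $I_i$ be a (shadowing) random variable with the inverse gamma density $\frac{\beta^\alpha}{\Gamma(\alpha)y^{\alpha+1}}e^{-\beta/y}$, $y>0$. Assume that for each $i$ the variables $N_{i,1},N_{i,2},I_1,\dots,I_L$ are mutually independent. Let $s$ be a random index with $I_s=\max_{1\le i\le L}I_i$, and let $$\gamma_{\rm out}=(N_{s,1}N_{s,2})^2\max_{1\le i\le L}I_i$$ be the output SNR of the shadowing-based selection. For $n=(n_1,\dots,n_\alpha)\in\mathbb Z_{\ge0}^\alpha$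 put $$p=p(n)=\alpha+\sum_{j=1}^\alpha (j-1)n_j,\qquad \mathcal B=\mathcal B(n)=L^{-p}\,\frac{L!}{n_1!\cdots n_\alpha!}\prod_{j=1}^\alpha\Big(\frac1{(j-1)!}\Big)^{n_j}.$$ Let $G^{m,n}_{p,q}(z\mid a;b)$ be Meijer's $G$-function, $$G^{m,n}_{p,q}\Big(z\,\Big|\begin{matrix}a_1,\dots,a_p\\ b_1,\dots,b_q\end{matrix}\Big)=\frac1{2\pi i}\int\frac{\prod_{j=1}^m\Gamma(b_j-u)\prod_{j=1}^n\Gamma(1-a_j+u)}{\prod_{j=m+1}^q\Gamma(1-b_j+u)\prod_{j=n+1}^p\Gamma(a_j-u)}\,z^u\,du,$$ the integral being along a vertical line that separates the poles of the $\Gamma(b_j-u)$, $j\le m$ (on its right) from those of the $\Gamma(1-a_j+u)$, $j\le n$ (on its left). Then $\gamma_{\rm out}$ is almost surely positive and has a probability density $f_{\gamma_{\rm out}}$ such that, for all $\gamma>0$, $$f_{\gamma_{\rm out}}(\gamma)=\frac{\mathcal S_2}{\gamma}\sum_{n_1+\cdots+n_\alpha=L-1}\mathcal B\;G^{2,1}_{1,2}\Big(\frac{\tilde\gamma\gamma}{L}\,\Big|\begin{matrix}1-p\\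 m_1,m_2\end{matrix}\Big),$$ and its distribution function satisfies, for all $\gamma>0$, $$F_{\gamma_{\rm out}}(\gamma)=\mathcal S_2\sum_{n_1+\cdots+n_\alpha=L-1}\mathcal B\;G^{2,2}_{2,3}\Big(\frac{\tilde\gamma\gamma}{L}\,\Big|\begin{matrix}1,\,1-p\\ m_1,m_2,0\end{matrix}\Big).$$ Moreover $\gamma_{\rm out}$ is integrable, and the average output SNR is $$\overline\gamma_{\rm out}=\mathbb E[\gamma_{\rm out}]=\int_0^\infty\gamma f_{\gamma_{\rm out}}(\gamma)\,d\gamma=\frac{L\overline\gamma}{\Gamma(\alpha)}\sum_{n_1+\cdots+n_\alpha=L-1}\mathcal B\,\Gamma(p-1).$$ -/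

import Mathlib

open MeasureTheory ProbabilityTheory
open scoped Nat

noncomputable section

/-- The Mellin-Barnes integrand of the Meijer function `G^{m,n}_{p,q}(z | a ; b)`:
`∏_{j ≤ m} Γ(b_j - s) ∏_{j ≤ n} Γ(1 - a_j + s) /
  (∏_{j > m} Γ(1 - b_j + s) ∏_{j > n} Γ(a_j - s)) * z ^ s`.
Mathlib's `Complex.Gamma` is `0` at its poles, so that `(Complex.Gamma w)⁻¹` is the entire
function `1 / Γ(w)` everywhere. -/
def meijerIntegrand (m n : ℕ) {p q : ℕ} (a : Fin p → ℂ) (b : Fin q → ℂ) (z s : ℂ) : ℂ :=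
  (∏ j : Fin q, if (j : ℕ) < m then Complex.Gamma (b j - s)
      else (Complex.Gamma (1 - b j + s))⁻¹) *
    (∏ j : Fin p, if (j : ℕ) < n then Complex.Gamma (1 - a j + s)
      else (Complex.Gamma (a j - s))⁻¹) * z ^ s

/-- The vertical line `Re s = c` separates the poles of `Γ(b_j - s)`, `j ≤ m` (which lie to its
right), from the poles of `Γ(1 - a_j + s)`, `j ≤ n` (which lie to its left). -/
def MeijerSeparates (m n : ℕ) {p q : ℕ} (a : Fin p → ℂ) (b : Fin q → ℂ) (c : ℝ) : Prop :=
  (∀ j : Fin q, (j : ℕ) < m → c < (b j).re) ∧ (∀ j : Fin p, (j : ℕ) < n → (a j).re - 1 < c)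

open Classical in
/-- Meijer's function `G^{m,n}_{p,q}(z | a ; b) = (1 / 2πi) ∫ φ(s) z ^ s ds`, the contour running
from `c - i∞` to `c + i∞` along a vertical line that separates the two families of poles
(so `s = c + i t`, `ds = i dt`; by Cauchy's theorem the choice of `c` is immaterial).
Junk value `0` if no vertical line separates them. -/
def meijerG (m n : ℕ) {p q : ℕ} (a : Fin p → ℂ) (b : Fin q → ℂ) (z : ℂ) : ℂ :=
  if h : ∃ c : ℝ, MeijerSeparates m n a b c then
    (1 / (2 * (Real.pi : ℂ))) *
      ∫ t : ℝ, meijerIntegrand m n a b z ((h.choose : ℂ) + (t : ℂ) * Complex.I)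
  else 0

/-- The density of the inverse gamma law with shape `α` and scale `β`. -/
def invGammaPDFReal (α β y : ℝ) : ℝ :=
  if 0 < y then β ^ α / (Real.Gamma α * y ^ (α + 1)) * Real.exp (-(β / y)) else 0

/-- The inverse gamma law with shape `α` and scale `β`. -/
def invGammaMeasure (α β : ℝ) : Measure ℝ :=
  volume.withDensity fun y => ENNReal.ofReal (invGammaPDFReal α β y)

/-- Output SNR of the shadowing-based selection: squared double-scattering multipath gain of the
selected UAV `s ω`, times the largest shadowing coefficient. -/
def outputSNR {S : Type*} {L : ℕ} (N : Fin L → Fin 2 → S → ℝ) (I : Fin L → S → ℝ)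
    (s : S → Fin L) (ω : S) : ℝ :=
  (N (s ω) 0 ω * N (s ω) 1 ω) ^ 2 * ⨆ i, I i ω

/-- Multi-indices `(n_1, …, n_α)` of natural numbers with `n_1 + ⋯ + n_α = L - 1`
(`Fin α` counts from `0`, so that `n_{j+1}` is `n j`). -/
def multiIndices (α L : ℕ) : Finset (Fin α → ℕ) :=
  Finset.piAntidiag Finset.univ (L - 1)

/-- `p = α + ∑_{j=1}^{α} (j - 1) n_j`. -/
def pExp {α : ℕ} (n : Fin α → ℕ) : ℕ := α + ∑ j : Fin α, (j : ℕ) * n j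

/-- `𝓑 = L^{-p} (L! / (n_1! ⋯ n_α!)) ∏_{j=1}^{α} (1 / (j - 1)!)^{n_j}`. -/
def coefB (L : ℕ) {α : ℕ} (n : Fin α → ℕ) : ℝ :=
  ((L : ℝ) ^ pExp n)⁻¹ * ((L ! : ℝ) / ∏ j : Fin α, ((n j)! : ℝ)) *
    ∏ j : Fin α, (1 / (((j : ℕ)! : ℕ) : ℝ)) ^ n j

/-- `𝓢₂ = 1 / (Γ(m₁) Γ(m₂) Γ(α))`. -/
def coefS (m₁ m₂ α : ℝ) : ℝ := 1 / (Real.Gamma m₁ * Real.Gamma m₂ * Real.Gamma α)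

end

/-!
Almost surely the `I_i` are pairwise distinct, so the selected index is a measurable function of
`(I_1, …, I_L)` alone. As the branches share one multipath law and each is independent of the `I_i`,
the multipath gain of the selected branch keeps its law and is independent of `max I_i`: the law of
`γ_out` is the multiplicative convolution of two gamma laws and the law of `max I_i`.

For integer shape `α` the inverse gamma distribution function is `F(y) = T(β / y)`, with `T` the
survival function of an Erlang law, that is `exp (-u)` times a polynomial in `u`. The density
`L F ^ (L - 1) F'` of `max I_i` therefore expands by the multinomial theorem, into a mixture of
inverse gamma densities of shape `p(n)` and scale `L β` with weights `𝓑(n) Γ(p(n)) / Γ(α)`.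

For each component of the mixture the complex moments of the product are products of Gamma
functions, namely the Mellin-Barnes integrand of `G^{2,1}_{1,2}`, and Mellin inversion gives the
density. The distribution function has the same Mellin transform up to the factor `1 / s`, which is
absorbed by the two further parameters of `G^{2,2}_{2,3}`; the mean is the moment of order one.
-/

open Set Filter Topology

/-! ### Complex moments and Mellin transforms -/

/-- The complex moment `∫ y ^ s dρ(y)` of a measure on `ℝ` exists and equals `c`. On a law carried
by `(0, ∞)` this is the Mellin transform of the law, and, unlike `HasMellin`, it does not refer to
a density. -/
def HasMellinMoment (ρ : Measure ℝ) (s c : ℂ) : Prop :=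
  Integrable (fun y : ℝ => (y : ℂ) ^ s) ρ ∧ ∫ y : ℝ, (y : ℂ) ^ s ∂ρ = c

theorem hasMellin_congr_Ioi {f g : ℝ → ℂ} {s c : ℂ} (h : HasMellin f s c)
    (hfg : EqOn f g (Ioi 0)) : HasMellin g s c := by
  have hE : EqOn (fun t : ℝ => (t : ℂ) ^ (s - 1) • f t) (fun t : ℝ => (t : ℂ) ^ (s - 1) • g t)
      (Ioi 0) := fun t ht => by simp only [hfg ht]
  exact ⟨(integrableOn_congr_fun hE measurableSet_Ioi).1 h.1,
    (setIntegral_congr_fun measurableSet_Ioi hE).symm.trans h.2⟩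

theorem hasMellin_exp_neg_mul {s : ℂ} (hs : 0 < s.re) {r : ℝ} (hr : 0 < r) :
    HasMellin (fun t : ℝ => ((Real.exp (-(r * t)) : ℝ) : ℂ)) s
      ((r : ℂ) ^ (-s) * Complex.Gamma s) := by
  have hexp : HasMellin (fun t : ℝ => ((Real.exp (-t) : ℝ) : ℂ)) s (Complex.Gamma s) := by
    constructor
    · simpa only [MellinConvergent, smul_eq_mul, mul_comm] using Complex.GammaIntegral_convergent hs
    · rw [Complex.Gamma_eq_integral hs, Complex.GammaIntegral_eq_mellin]
  refine ⟨(MellinConvergent.comp_mul_left hr).2 hexp.1, ?_⟩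
  rw [mellin_comp_mul_left (fun t : ℝ => ((Real.exp (-t) : ℝ) : ℂ)) s hr, hexp.2, smul_eq_mul]

theorem self_mul_gammaPDFReal {a r x : ℝ} (hx : 0 < x) :
    x * gammaPDFReal a r x = r ^ a / Real.Gamma a * (x ^ a * Real.exp (-(r * x))) := by
  rw [gammaPDFReal, if_pos hx.le, Real.rpow_sub_one hx.ne']
  field_simp

theorem hasMellin_self_mul_gammaPDFReal {a r : ℝ} (hr : 0 < r) {s : ℂ} (hs : -a < s.re) :
    HasMellin (fun u : ℝ => ((u * gammaPDFReal a r u : ℝ) : ℂ)) s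
      ((r : ℂ) ^ (-s) * Complex.Gamma (a + s) / Complex.Gamma a) := by
  have hexp := hasMellin_exp_neg_mul (s := s + a) (by simpa using neg_lt_iff_pos_add.1 hs) hr
  have hpow := hasMellin_const_smul (MellinConvergent.cpow_smul.2 hexp.1)
    ((r ^ a / Real.Gamma a : ℝ) : ℂ)
  rw [mellin_cpow_smul, hexp.2] at hpow
  have hr' : (r : ℂ) ≠ 0 := by exact_mod_cast hr.ne'
  have hra : (r : ℂ) ^ (a : ℂ) ≠ 0 := by simp [Complex.cpow_eq_zero_iff, hr']
  convert! hasMellin_congr_Ioi hpow (g := fun u : ℝ => ((u * gammaPDFReal a r u : ℝ) : ℂ)) ?_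
    using 1
  · rw [smul_eq_mul, neg_add, Complex.cpow_add _ _ hr', Complex.cpow_neg _ (a : ℂ), add_comm s,
      Complex.ofReal_div, Complex.ofReal_cpow hr.le, Complex.Gamma_ofReal]
    field_simp
  · intro x (hx : 0 < x)
    simp only [self_mul_gammaPDFReal hx, smul_eq_mul, ← Complex.ofReal_cpow hx.le,
      ← Complex.ofReal_mul]

theorem self_mul_invGammaPDFReal {p b x : ℝ} (hb : 0 < b) (hx : 0 < x) :
    x * invGammaPDFReal p b x = x⁻¹ * gammaPDFReal p b x⁻¹ := by
  rw [self_mul_gammaPDFReal (inv_pos.2 hx), invGammaPDFReal, if_pos hx, Real.inv_rpow hx.le,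
    Real.rpow_add_one hx.ne', div_eq_mul_inv b]
  have := (Real.rpow_pos_of_pos hx p).ne'
  field_simp

theorem hasMellin_self_mul_invGammaPDFReal {p b : ℝ} (hb : 0 < b) {s : ℂ} (hs : s.re < p) :
    HasMellin (fun u : ℝ => ((u * invGammaPDFReal p b u : ℝ) : ℂ)) s
      ((b : ℂ) ^ s * Complex.Gamma (p - s) / Complex.Gamma p) := by
  have hgamma := hasMellin_self_mul_gammaPDFReal (a := p) hb (s := -s) (by simpa using hs)
  refine hasMellin_congr_Ioi (f := fun u : ℝ => ((u⁻¹ * gammaPDFReal p b u⁻¹ : ℝ) : ℂ)) ⟨?_, ?_⟩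
    fun x hx => by simp only [self_mul_invGammaPDFReal hb hx]
  · have := (MellinConvergent.comp_rpow (f := fun u : ℝ => ((u * gammaPDFReal p b u : ℝ) : ℂ))
      (s := s) (a := -1) (by norm_num)).2 (by simpa [div_neg] using hgamma.1)
    simpa only [Real.rpow_neg_one] using this
  · rw [mellin_comp_inv (fun u : ℝ => ((u * gammaPDFReal p b u : ℝ) : ℂ)), hgamma.2, neg_neg,
      sub_eq_add_neg]

theorem ae_pos_withDensity {g : ℝ → ℝ} (hg : Measurable g) (hneg : ∀ x < 0, g x = 0) :
    ∀ᵐ x ∂(volume.withDensity fun x => ENNReal.ofReal (g x)), 0 < x := by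
  rw [ae_withDensity_iff hg.ennreal_ofReal]
  filter_upwards [Measure.ae_ne volume (0 : ℝ)] with x hx hgx
  by_contra hneg_x
  exact hgx (by simp [hneg x (lt_of_le_of_ne (not_lt.1 hneg_x) hx)])

theorem hasMellinMoment_withDensity_iff {g : ℝ → ℝ} (hg : Measurable g) (hg0 : ∀ x, 0 ≤ g x)
    (hneg : ∀ x < 0, g x = 0) {s c : ℂ} :
    HasMellinMoment (volume.withDensity fun x => ENNReal.ofReal (g x)) s c ↔
      HasMellin (fun u : ℝ => ((u * g u : ℝ) : ℂ)) s c := by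
  have hm : Measurable fun x => ENNReal.ofReal (g x) := hg.ennreal_ofReal
  have hlt : ∀ᵐ x ∂(volume : Measure ℝ), ENNReal.ofReal (g x) < ⊤ := by simp
  have hind : (fun x : ℝ => (ENNReal.ofReal (g x)).toReal • (x : ℂ) ^ s) =ᵐ[volume]
      (Ioi (0 : ℝ)).indicator fun t : ℝ => (t : ℂ) ^ (s - 1) • ((t * g t : ℝ) : ℂ) := by
    filter_upwards [Measure.ae_ne volume (0 : ℝ)] with x hx
    rw [ENNReal.toReal_ofReal (hg0 x)]
    rcases lt_or_gt_of_ne hx with hlt | hgt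
    · rw [hneg x hlt, indicator_of_notMem (by simpa using hlt.le), zero_smul]
    · have hx' : (x : ℂ) ≠ 0 := by exact_mod_cast hx
      rw [indicator_of_mem (by simpa using hgt), Complex.cpow_sub _ _ hx', Complex.cpow_one,
        Complex.real_smul, smul_eq_mul, Complex.ofReal_mul]
      field_simp
  rw [HasMellinMoment, integrable_withDensity_iff_integrable_smul' hm hlt, integrable_congr hind,
    integrable_indicator_iff measurableSet_Ioi, integral_withDensity_eq_integral_toReal_smul hm hlt,
    integral_congr_ae hind, integral_indicator measurableSet_Ioi]
  rfl

theorem gammaPDFReal_of_neg {a r x : ℝ} (hx : x < 0) : gammaPDFReal a r x = 0 :=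
  if_neg hx.not_ge

theorem hasMellinMoment_gammaMeasure {a r : ℝ} (ha : 0 < a) (hr : 0 < r) {s : ℂ}
    (hs : -a < s.re) : HasMellinMoment (gammaMeasure a r) s
      ((r : ℂ) ^ (-s) * Complex.Gamma (a + s) / Complex.Gamma a) :=
  (hasMellinMoment_withDensity_iff (measurable_gammaPDFReal a r) (gammaPDFReal_nonneg ha hr)
    fun _ => gammaPDFReal_of_neg).2 (hasMellin_self_mul_gammaPDFReal hr hs)

instance sFinite_gammaMeasure (a r : ℝ) : SFinite (gammaMeasure a r) := by
  unfold gammaMeasure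
  infer_instance

theorem ae_pos_gammaMeasure (a r : ℝ) : ∀ᵐ x ∂(gammaMeasure a r), 0 < x :=
  ae_pos_withDensity (measurable_gammaPDFReal a r) fun _ => gammaPDFReal_of_neg

theorem invGammaPDFReal_of_nonpos {p b x : ℝ} (hx : x ≤ 0) : invGammaPDFReal p b x = 0 :=
  if_neg hx.not_gt

theorem measurable_invGammaPDFReal (p b : ℝ) : Measurable (invGammaPDFReal p b) := by
  unfold invGammaPDFReal
  exact Measurable.ite measurableSet_Ioi (by fun_prop) measurable_const

theorem invGammaPDFReal_nonneg {p b : ℝ} (hp : 0 < p) (hb : 0 < b) (x : ℝ) :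
    0 ≤ invGammaPDFReal p b x := by
  unfold invGammaPDFReal
  have := Real.Gamma_pos_of_pos hp
  split_ifs <;> positivity

theorem hasMellinMoment_invGammaMeasure {p b : ℝ} (hp : 0 < p) (hb : 0 < b) {s : ℂ}
    (hs : s.re < p) : HasMellinMoment (invGammaMeasure p b) s
      ((b : ℂ) ^ s * Complex.Gamma (p - s) / Complex.Gamma p) :=
  (hasMellinMoment_withDensity_iff (measurable_invGammaPDFReal p b) (invGammaPDFReal_nonneg hp hb)
    fun _ hx => invGammaPDFReal_of_nonpos hx.le).2 (hasMellin_self_mul_invGammaPDFReal hb hs)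

instance sFinite_invGammaMeasure (p b : ℝ) : SFinite (invGammaMeasure p b) := by
  unfold invGammaMeasure
  infer_instance

theorem ae_pos_invGammaMeasure (p b : ℝ) : ∀ᵐ x ∂(invGammaMeasure p b), 0 < x :=
  ae_pos_withDensity (measurable_invGammaPDFReal p b) fun _ hx => invGammaPDFReal_of_nonpos hx.le

theorem HasMellinMoment.isProbabilityMeasure {ρ : Measure ℝ} (h : HasMellinMoment ρ 0 1) :
    IsProbabilityMeasure ρ := by
  obtain ⟨_, hmass⟩ := h
  simp only [Complex.cpow_zero, integral_const, Complex.real_smul, mul_one,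
    Complex.ofReal_eq_one] at hmass
  exact ⟨(ENNReal.toReal_eq_one_iff _).1 hmass⟩

theorem isProbabilityMeasure_invGammaMeasure {p b : ℝ} (hp : 0 < p) (hb : 0 < b) :
    IsProbabilityMeasure (invGammaMeasure p b) := by
  have hG : Complex.Gamma p ≠ 0 := by
    rw [Complex.Gamma_ofReal]
    exact_mod_cast (Real.Gamma_pos_of_pos hp).ne'
  exact HasMellinMoment.isProbabilityMeasure (by
    simpa [hG] using hasMellinMoment_invGammaMeasure hp hb (s := 0) (by simpa using hp))

theorem ae_pos_mconv {ρ τ : Measure ℝ} (hρ : ∀ᵐ x ∂ρ, 0 < x) (hτ : ∀ᵐ x ∂τ, 0 < x) :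
    ∀ᵐ x ∂(ρ ∗ₘ τ), 0 < x := by
  rw [Measure.mconv, ae_map_iff measurable_mul.aemeasurable measurableSet_Ioi]
  filter_upwards [Measure.quasiMeasurePreserving_fst.ae hρ,
    Measure.quasiMeasurePreserving_snd.ae hτ] with z h1 h2 using mul_pos h1 h2

theorem HasMellinMoment.mconv {ρ τ : Measure ℝ} [SFinite ρ] [SFinite τ]
    (hρ : ∀ᵐ x ∂ρ, 0 < x) (hτ : ∀ᵐ x ∂τ, 0 < x) {s c d : ℂ} (hρs : HasMellinMoment ρ s c)
    (hτs : HasMellinMoment τ s d) : HasMellinMoment (ρ ∗ₘ τ) s (c * d) := by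
  have hm : Measurable fun y : ℝ => (y : ℂ) ^ s := by fun_prop
  have hae : (fun z : ℝ × ℝ => ((z.1 * z.2 : ℝ) : ℂ) ^ s) =ᵐ[ρ.prod τ]
      fun z => (z.1 : ℂ) ^ s * (z.2 : ℂ) ^ s := by
    filter_upwards [Measure.quasiMeasurePreserving_fst.ae hρ,
      Measure.quasiMeasurePreserving_snd.ae hτ] with z h1 h2
    rw [Complex.ofReal_mul, Complex.mul_cpow_ofReal_nonneg h1.le h2.le]
  constructor
  · rw [Measure.mconv, integrable_map_measure hm.aestronglyMeasurable measurable_mul.aemeasurable]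
    exact (integrable_congr hae).2 (hρs.1.mul_prod hτs.1)
  · rw [Measure.mconv, integral_map measurable_mul.aemeasurable hm.aestronglyMeasurable,
      integral_congr_ae hae, ← hρs.2, ← hτs.2]
    exact integral_prod_mul (fun y : ℝ => (y : ℂ) ^ s) (fun y : ℝ => (y : ℂ) ^ s)

/-! ### Densities of products of independent variables -/

theorem hasMellin_comp_div {k : ℝ → ℂ} {s c : ℂ} (hk : HasMellin k s c) {y : ℝ} (hy : 0 < y) :
    HasMellin (fun x => k (x / y)) s ((y : ℂ) ^ s * c) := by
  have hy' : 0 < y⁻¹ := inv_pos.2 hy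
  simp only [div_eq_inv_mul]
  refine ⟨(MellinConvergent.comp_mul_left hy').2 hk.1, ?_⟩
  rw [mellin_comp_mul_left _ _ hy', hk.2, smul_eq_mul, Complex.ofReal_inv, Complex.inv_cpow _ _
    (by simpa [Complex.arg_ofReal_of_nonneg hy.le] using Real.pi_pos.ne), Complex.cpow_neg, inv_inv]

theorem integral_norm_mellin_comp_div (k : ℝ → ℂ) (s : ℂ) {y : ℝ} (hy : 0 < y) :
    ∫ x in Ioi (0 : ℝ), ‖(x : ℂ) ^ (s - 1) • k (x / y)‖ =
      ‖(y : ℂ) ^ s‖ * ∫ x in Ioi (0 : ℝ), ‖(x : ℂ) ^ (s - 1) • k x‖ := by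
  have hsubst := integral_comp_mul_left_Ioi (fun x : ℝ => ‖(x : ℂ) ^ (s - 1) • k x‖) 0
    (inv_pos.2 hy)
  rw [mul_zero, inv_inv, smul_eq_mul] at hsubst
  have hnorm : ‖(y : ℂ) ^ s‖ = ‖(y : ℂ) ^ (s - 1)‖ * y := by
    rw [Complex.norm_cpow_eq_rpow_re_of_pos hy, Complex.norm_cpow_eq_rpow_re_of_pos hy,
      Complex.sub_re, Complex.one_re, Real.rpow_sub_one hy.ne', div_mul_cancel₀ _ hy.ne']
  rw [hnorm, mul_assoc, ← hsubst, ← integral_const_mul]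
  refine setIntegral_congr_fun measurableSet_Ioi fun x hx => ?_
  rw [← norm_mul, smul_eq_mul, smul_eq_mul, ← mul_assoc,
    ← Complex.mul_cpow_ofReal_nonneg hy.le (mul_pos (inv_pos.2 hy) hx).le,
    ← Complex.ofReal_mul, mul_inv_cancel_left₀ hy.ne', div_eq_inv_mul]

theorem hasMellin_integral_comp_div {k : ℝ → ℂ} (hk : Measurable k) {ρ : Measure ℝ} [SFinite ρ]
    (hρ : ∀ᵐ y ∂ρ, 0 < y) {s c d : ℂ} (hks : HasMellin k s c) (hρs : HasMellinMoment ρ s d) :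
    HasMellin (fun x => ∫ y, k (x / y) ∂ρ) s (c * d) := by
  have hm : Measurable fun z : ℝ × ℝ => (z.2 : ℂ) ^ (s - 1) • k (z.2 / z.1) := by fun_prop
  have hint : Integrable (fun z : ℝ × ℝ => (z.2 : ℂ) ^ (s - 1) • k (z.2 / z.1))
      (ρ.prod (volume.restrict (Ioi 0))) := by
    rw [integrable_prod_iff hm.aestronglyMeasurable]
    refine ⟨hρ.mono fun y hy => (hasMellin_comp_div hks hy).1,
      (hρs.1.norm.mul_const (∫ x in Ioi (0 : ℝ), ‖(x : ℂ) ^ (s - 1) • k x‖)).congr ?_⟩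
    exact hρ.mono fun y hy => (integral_norm_mellin_comp_div k s hy).symm
  constructor
  · simpa only [MellinConvergent, integral_smul] using! hint.integral_prod_right
  · simp only [mellin, ← integral_smul]
    rw [← integral_integral_swap hint, ← hρs.2, ← integral_const_mul]
    exact integral_congr_ae (hρ.mono fun y hy =>
      (hasMellin_comp_div hks hy).2.trans (mul_comm _ _))

theorem continuousAt_integral_comp_div {E : Type*} [NormedAddCommGroup E] [NormedSpace ℝ E]
    {k : ℝ → E} (hk : StronglyMeasurable k) {C : ℝ} (hC : ∀ u, ‖k u‖ ≤ C)
    {ρ : Measure ℝ} [IsFiniteMeasure ρ] {x : ℝ} (hx : ∀ᵐ y ∂ρ, ContinuousAt k (x / y)) :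
    ContinuousAt (fun x => ∫ y, k (x / y) ∂ρ) x := by
  refine continuousAt_of_dominated (bound := fun _ => C) (Eventually.of_forall fun z => ?_)
    (Eventually.of_forall fun z => Eventually.of_forall fun y => hC _) (integrable_const _) ?_
  · exact (hk.comp_measurable (by fun_prop)).aestronglyMeasurable
  · filter_upwards [hx] with y hxy
    exact ContinuousAt.comp (f := fun x : ℝ => x / y) hxy (by fun_prop)

theorem lintegral_comp_mul_left_withDensity {g f : ℝ → ENNReal} (hg : Measurable g)
    (hf : Measurable f) {y : ℝ} (hy : 0 < y) : ∫⁻ x, f (y * x) ∂(volume.withDensity g) =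
      ∫⁻ z, ENNReal.ofReal y⁻¹ * g (z / y) * f z := by
  have hm : Measurable fun z => g (z / y) * f z := by fun_prop
  have hmap : ∫⁻ x, (g * fun x => f (y * x)) x =
      ∫⁻ z, g (z / y) * f z ∂(Measure.map (y * ·) volume) := by
    rw [lintegral_map hm (by fun_prop)]
    simp only [Pi.mul_apply, mul_div_cancel_left₀ _ hy.ne']
  rw [lintegral_withDensity_eq_lintegral_mul _ hg (by fun_prop), hmap,
    Real.map_volume_mul_left hy.ne', lintegral_smul_measure, smul_eq_mul,
    ← lintegral_const_mul _ hm, abs_of_pos (inv_pos.2 hy)]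
  simp only [mul_assoc]

/-- The density of `X * Y`, where `X` has density `g` and `Y` is independent of `X`, positive, with
law `ρ`. The kernel `u * g u` is singled out because its Mellin transform at `s` is the moment
`E[X ^ s]`. At `x = 0` the value is `0`, because `0⁻¹ = 0`. -/
noncomputable def mconvPDF (g : ℝ → ℝ) (ρ : Measure ℝ) (x : ℝ) : ℝ :=
  x⁻¹ * ∫ y, x / y * g (x / y) ∂ρ

section mconvPDF

variable {g : ℝ → ℝ} {ρ : Measure ℝ}

theorem measurable_mconvPDF (hg : Measurable g) (ρ : Measure ℝ) [SFinite ρ] :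
    Measurable (mconvPDF g ρ) := by
  have hm : StronglyMeasurable fun z : ℝ × ℝ => z.1 / z.2 * g (z.1 / z.2) :=
    Measurable.stronglyMeasurable (by fun_prop)
  exact measurable_inv.mul hm.integral_prod_right.measurable

theorem mconvPDF_of_nonpos (hneg : ∀ u < 0, g u = 0) (hρ : ∀ᵐ y ∂ρ, 0 < y) {x : ℝ}
    (hx : x ≤ 0) : mconvPDF g ρ x = 0 := by
  rcases hx.lt_or_eq with hx | rfl
  · rw [mconvPDF, integral_eq_zero_of_ae, mul_zero]
    filter_upwards [hρ] with y hy
    simp [hneg _ (div_neg_of_neg_of_pos hx hy)]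
  · rw [mconvPDF, inv_zero, zero_mul]

theorem mconvPDF_nonneg (hg0 : ∀ u, 0 ≤ g u) (hρ : ∀ᵐ y ∂ρ, 0 < y) (x : ℝ) :
    0 ≤ mconvPDF g ρ x := by
  rw [mconvPDF, ← integral_const_mul]
  refine integral_nonneg_of_ae (hρ.mono fun y hy => ?_)
  have hsq : x⁻¹ * (x / y * g (x / y)) = x⁻¹ * x * (g (x / y) / y) := by ring
  simp only [hsq]
  exact mul_nonneg (by rcases eq_or_ne x 0 with rfl | hx <;> simp [*]) (div_nonneg (hg0 _) hy.le)

theorem lintegral_comp_div_eq_ofReal_mconvPDF [IsFiniteMeasure ρ] (hg : Measurable g)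
    (hg0 : ∀ u, 0 ≤ g u) {C : ℝ} (hC : ∀ u, ‖u * g u‖ ≤ C) (hρ : ∀ᵐ y ∂ρ, 0 < y)
    {x : ℝ} (hx : x ≠ 0) :
    ∫⁻ y, ENNReal.ofReal y⁻¹ * ENNReal.ofReal (g (x / y)) ∂ρ =
      ENNReal.ofReal (mconvPDF g ρ x) := by
  have hkernel : ∀ y, x⁻¹ * (x / y * g (x / y)) = y⁻¹ * g (x / y) := fun y => by field_simp
  rw [mconvPDF, ← integral_const_mul, ofReal_integral_eq_lintegral_ofReal]
  · refine lintegral_congr_ae (hρ.mono fun y hy => ?_)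
    simp only [hkernel, ENNReal.ofReal_mul (inv_pos.2 hy).le]
  · refine (Integrable.of_bound (C := C) ?_ (Eventually.of_forall fun y => hC _)).const_mul _
    exact Measurable.aestronglyMeasurable (by fun_prop)
  · filter_upwards [hρ] with y hy
    rw [hkernel]
    exact mul_nonneg (inv_pos.2 hy).le (hg0 _)

theorem withDensity_mconv [IsFiniteMeasure ρ] (hg : Measurable g) (hg0 : ∀ u, 0 ≤ g u)
    {C : ℝ} (hC : ∀ u, ‖u * g u‖ ≤ C) (hρ : ∀ᵐ y ∂ρ, 0 < y) :
    (volume.withDensity fun u => ENNReal.ofReal (g u)) ∗ₘ ρ =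
      volume.withDensity fun x => ENNReal.ofReal (mconvPDF g ρ x) := by
  ext A hA
  have hind : Measurable (A.indicator (1 : ℝ → ENNReal)) := measurable_one.indicator hA
  rw [Measure.mconv_comm, ← lintegral_indicator_one hA, Measure.lintegral_mconv hind,
    withDensity_apply _ hA, ← lintegral_indicator hA]
  rw [lintegral_congr_ae (hρ.mono fun y hy =>
      lintegral_comp_mul_left_withDensity hg.ennreal_ofReal hind hy),
    lintegral_lintegral_swap (by fun_prop)]
  refine lintegral_congr_ae ((Measure.ae_ne volume (0 : ℝ)).mono fun x hx => ?_)
  by_cases hxA : x ∈ A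
  · simpa [hxA] using lintegral_comp_div_eq_ofReal_mconvPDF hg hg0 hC hρ hx
  · simp [hxA]

theorem continuousAt_self_mul_mconvPDF [IsFiniteMeasure ρ] (hg : Measurable g)
    (hcont : ∀ u > 0, ContinuousAt (fun u => u * g u) u) {C : ℝ} (hC : ∀ u, ‖u * g u‖ ≤ C)
    (hρ : ∀ᵐ y ∂ρ, 0 < y) {x : ℝ} (hx : 0 < x) :
    ContinuousAt (fun x => x * mconvPDF g ρ x) x := by
  have hk : Measurable fun u => u * g u := by fun_prop
  refine (continuousAt_integral_comp_div hk.stronglyMeasurable hC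
    (hρ.mono fun y hy => hcont _ (div_pos hx hy))).congr ?_
  filter_upwards [lt_mem_nhds hx] with z hz using (mul_inv_cancel_left₀ hz.ne' _).symm

end mconvPDF

theorem rpow_mul_exp_neg_le {a r u : ℝ} (ha : 0 < a) (hr : 0 < r) (hu : 0 ≤ u) :
    u ^ a * Real.exp (-(r * u)) ≤ (a / r) ^ a := by
  have hexp : (r * u / a) ^ a ≤ Real.exp (r * u) := by
    calc (r * u / a) ^ a ≤ Real.exp (r * u / a) ^ a := by
          gcongr
          linarith [Real.add_one_le_exp (r * u / a)]
      _ = Real.exp (r * u) := by rw [← Real.exp_mul, div_mul_cancel₀ _ ha.ne']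
  rw [Real.exp_neg, ← div_eq_mul_inv, div_le_iff₀ (Real.exp_pos _)]
  calc u ^ a = (a / r) ^ a * (r * u / a) ^ a := by
        rw [← Real.mul_rpow (by positivity) (by positivity)]
        congr 1
        field_simp
    _ ≤ (a / r) ^ a * Real.exp (r * u) := by gcongr

theorem norm_self_mul_gammaPDFReal_le {a r : ℝ} (ha : 0 < a) (hr : 0 < r) (u : ℝ) :
    ‖u * gammaPDFReal a r u‖ ≤ r ^ a / Real.Gamma a * (a / r) ^ a := by
  have := Real.Gamma_pos_of_pos ha
  rcases lt_trichotomy u 0 with hu | rfl | hu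
  · rw [gammaPDFReal_of_neg hu, mul_zero, norm_zero]
    positivity
  · rw [zero_mul, norm_zero]
    positivity
  · rw [Real.norm_of_nonneg (mul_nonneg hu.le (gammaPDFReal_nonneg ha hr u)),
      self_mul_gammaPDFReal hu]
    gcongr
    exact rpow_mul_exp_neg_le ha hr hu.le

theorem continuousAt_self_mul_gammaPDFReal (a r : ℝ) {u : ℝ} (hu : 0 < u) :
    ContinuousAt (fun u => u * gammaPDFReal a r u) u := by
  have hcont : ContinuousAt (fun u => r ^ a / Real.Gamma a * (u ^ a * Real.exp (-(r * u)))) u :=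
    continuousAt_const.mul ((Real.continuousAt_rpow_const _ _ (Or.inl hu.ne')).mul (by fun_prop))
  refine hcont.congr ?_
  filter_upwards [lt_mem_nhds hu] with v hv using (self_mul_gammaPDFReal hv).symm

/-! ### Mellin inversion and Meijer functions -/

theorem norm_Gamma_le_of_re_pos {s : ℂ} (hs : 0 < s.re) : ‖Complex.Gamma s‖ ≤ Real.Gamma s.re := by
  rw [Complex.Gamma_eq_integral hs, Real.Gamma_eq_integral hs, Complex.GammaIntegral]
  refine (norm_integral_le_integral_norm _).trans_eq ?_
  refine setIntegral_congr_fun measurableSet_Ioi fun x hx => ?_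
  rw [norm_mul, Complex.norm_cpow_eq_rpow_re_of_pos hx, Complex.sub_re, Complex.one_re,
    Complex.norm_real, Real.norm_of_nonneg (Real.exp_pos _).le]

/- Two applications of the functional equation, `Γ(s) = Γ(s + 2) / (s (s + 1))`, turn the uniform
bound into quadratic decay. -/
theorem norm_Gamma_le_div_normSq {s : ℂ} (hs : 0 < s.re) :
    ‖Complex.Gamma s‖ ≤ Real.Gamma (s.re + 2) / Complex.normSq s := by
  have hs0 : s ≠ 0 := fun h => by simp [h] at hs
  have hs1 : s + 1 ≠ 0 := fun h => by
    have := congrArg Complex.re h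
    simp only [Complex.add_re, Complex.one_re, Complex.zero_re] at this
    linarith
  have hrec : Complex.Gamma (s + 2) = (s + 1) * (s * Complex.Gamma s) := by
    rw [← Complex.Gamma_add_one s hs0, ← Complex.Gamma_add_one _ hs1, add_assoc, one_add_one_eq_two]
  have hshift : ‖Complex.Gamma (s + 2)‖ ≤ Real.Gamma (s.re + 2) := by
    simpa using norm_Gamma_le_of_re_pos (s := s + 2) (by simp; linarith)
  have hnorm : ‖s‖ ≤ ‖s + 1‖ := by
    rw [← sq_le_sq₀ (norm_nonneg _) (norm_nonneg _), Complex.sq_norm, Complex.sq_norm,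
      Complex.normSq_apply, Complex.normSq_apply, Complex.add_re, Complex.add_im, Complex.one_re,
      Complex.one_im]
    nlinarith
  rw [le_div_iff₀ (Complex.normSq_pos.2 hs0), Complex.normSq_eq_norm_sq]
  calc ‖Complex.Gamma s‖ * ‖s‖ ^ 2 = ‖s‖ * (‖s‖ * ‖Complex.Gamma s‖) := by ring
    _ ≤ ‖s + 1‖ * (‖s‖ * ‖Complex.Gamma s‖) := by gcongr
    _ = ‖Complex.Gamma (s + 2)‖ := by rw [hrec, norm_mul, norm_mul]
    _ ≤ Real.Gamma (s.re + 2) := hshift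

theorem continuous_Gamma_comp {X : Type*} [TopologicalSpace X] {g : X → ℂ} (hg : Continuous g)
    (hpos : ∀ t, 0 < (g t).re) : Continuous fun t => Complex.Gamma (g t) := by
  refine continuous_iff_continuousAt.2 fun t => ContinuousAt.comp (f := g) ?_ hg.continuousAt
  refine Complex.continuousAt_Gamma _ fun n h => (hpos t).not_ge ?_
  simp [h]

theorem verticalIntegrable_Gamma {c : ℝ} (hc : 0 < c) :
    Complex.VerticalIntegrable Complex.Gamma c := by
  have hbound : Integrable fun t : ℝ => Real.Gamma (c + 2) / (c ^ 2 + t ^ 2) := by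
    refine ((integrable_inv_one_add_sq.comp_div hc.ne').const_mul
      (Real.Gamma (c + 2) / c ^ 2)).congr (Eventually.of_forall fun t => ?_)
    simp only
    field_simp
  refine hbound.mono' (continuous_Gamma_comp (by fun_prop) (by simpa using hc)).aestronglyMeasurable
    (Eventually.of_forall fun t => ?_)
  have hdecay := norm_Gamma_le_div_normSq (s := c + t * Complex.I) (by simpa using hc)
  simpa [Complex.normSq_apply, ← sq] using hdecay

theorem integrable_mul_Gamma_comp {f g : ℝ → ℂ} (hf : Integrable f) (hg : Continuous g) {σ : ℝ}
    (hσ : 0 < σ) (hre : ∀ t, (g t).re = σ) : Integrable fun t => f t * Complex.Gamma (g t) :=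
  hf.mul_bdd (c := Real.Gamma σ)
    (continuous_Gamma_comp hg fun t => by rwa [hre]).aestronglyMeasurable
    (Eventually.of_forall fun t => by
      simpa only [hre] using norm_Gamma_le_of_re_pos (s := g t) (by rwa [hre]))

section meijer

variable {m n p q : ℕ} {a : Fin p → ℂ} {b : Fin q → ℂ}

theorem meijerIntegrand_ofReal_mul {w x : ℝ} (hw : 0 ≤ w) (hx : 0 ≤ x) (s : ℂ) :
    meijerIntegrand m n a b ((w * x : ℝ) : ℂ) s = meijerIntegrand m n a b w s * (x : ℂ) ^ s := by
  rw [meijerIntegrand, meijerIntegrand, Complex.ofReal_mul, Complex.mul_cpow_ofReal_nonneg hw hx]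
  ring

/- Mellin inversion. The Mellin variable is `-s`: the Mellin transform integrates against
`x ^ (s - 1)` and its inverse against `x ^ (-s)`, whereas Meijer's integrand carries `z ^ s`. -/
theorem eq_meijerG_of_hasMellin {g : ℝ → ℂ} {K : ℂ} {w x : ℝ} (hw : 0 ≤ w) (hx : 0 < x)
    (hsep : ∃ c : ℝ, MeijerSeparates m n a b c)
    (hmellin : ∀ s : ℂ, MeijerSeparates m n a b s.re →
      HasMellin g (-s) (K * meijerIntegrand m n a b w s))
    (hint : ∀ c, MeijerSeparates m n a b c →
      Complex.VerticalIntegrable (meijerIntegrand m n a b w) c)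
    (hcont : ContinuousAt g x) : g x = K * meijerG m n a b ((w * x : ℝ) : ℂ) := by
  rw [meijerG, dif_pos hsep]
  set c := hsep.choose
  have hc : MeijerSeparates m n a b c := hsep.choose_spec
  have hline (t : ℝ) : HasMellin g (((-c : ℝ) : ℂ) + t * Complex.I)
      (K * meijerIntegrand m n a b w (c + ((-t : ℝ) : ℂ) * Complex.I)) := by
    convert! hmellin (c + ((-t : ℝ) : ℂ) * Complex.I) (by simpa using hc) using 1
    push_cast
    ring
  have hvert : Complex.VerticalIntegrable (mellin g) (-c) := by
    refine (((hint c hc).comp_neg).const_mul K).congr (Eventually.of_forall fun t => ?_)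
    exact (hline t).2.symm
  have hinv := mellinInv_mellin_eq (-c) g hx (by simpa using (hline 0).1) hvert hcont
  rw [← hinv, mellinInv, ← integral_neg_eq_self]
  simp_rw [(hline _).2, meijerIntegrand_ofReal_mul hw hx.le]
  rw [Complex.real_smul, mul_left_comm, ← integral_const_mul K]
  congr 1
  · push_cast
    ring
  · refine integral_congr_ae (Eventually.of_forall fun t => ?_)
    have hneg : -(((-c : ℝ) : ℂ) + ((-t : ℝ) : ℂ) * Complex.I) = c + t * Complex.I := by
      push_cast
      ring
    simp only [hneg, neg_neg, smul_eq_mul]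
    ring

end meijer

section meijerGammaGammaInvGamma

variable {a₁ a₂ p c : ℝ}

theorem meijerSeparates_two_one_iff :
    MeijerSeparates 2 1 ![1 - (p : ℂ)] ![(a₁ : ℂ), (a₂ : ℂ)] c ↔ -p < c ∧ c < a₁ ∧ c < a₂ := by
  simp [MeijerSeparates, Fin.forall_fin_two, and_comm]

theorem meijerSeparates_two_two_iff :
    MeijerSeparates 2 2 ![1, 1 - (p : ℂ)] ![(a₁ : ℂ), (a₂ : ℂ), 0] c ↔
      0 < c ∧ -p < c ∧ c < a₁ ∧ c < a₂ := by
  simp [MeijerSeparates, Fin.forall_fin_succ, and_comm, and_assoc]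

theorem meijerIntegrand_two_one (a₁ a₂ p z s : ℂ) :
    meijerIntegrand 2 1 ![1 - p] ![a₁, a₂] z s =
      Complex.Gamma (a₁ - s) * Complex.Gamma (a₂ - s) * Complex.Gamma (p + s) * z ^ s := by
  simp [meijerIntegrand, Fin.prod_univ_two]

theorem meijerIntegrand_two_two (a₁ a₂ p z : ℂ) {s : ℂ} (hs : 0 < s.re) :
    meijerIntegrand 2 2 ![1, 1 - p] ![a₁, a₂, 0] z s =
      meijerIntegrand 2 1 ![1 - p] ![a₁, a₂] z s * s⁻¹ := by
  have hs0 : s ≠ 0 := fun h => by simp [h] at hs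
  have hG : Complex.Gamma s ≠ 0 := Complex.Gamma_ne_zero_of_re_pos hs
  have hinv : s⁻¹ = (Complex.Gamma (1 + s))⁻¹ * Complex.Gamma s := by
    rw [add_comm, Complex.Gamma_add_one _ hs0, mul_inv, inv_mul_cancel_right₀ hG]
  rw [meijerIntegrand_two_one, hinv]
  simp [meijerIntegrand, Fin.prod_univ_two, Fin.prod_univ_three, -mul_eq_mul_right_iff, mul_assoc,
    mul_comm, mul_left_comm]

theorem verticalIntegrable_meijerIntegrand_two_one {w : ℝ} (hw : 0 < w) (hp : -p < c) (h₁ : c < a₁)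
    (h₂ : c < a₂) : Complex.VerticalIntegrable
      (meijerIntegrand 2 1 ![1 - (p : ℂ)] ![(a₁ : ℂ), (a₂ : ℂ)] w) c := by
  have hGamma₁ : Integrable fun t : ℝ => Complex.Gamma (a₁ - (c + t * Complex.I)) := by
    refine ((verticalIntegrable_Gamma (sub_pos.2 h₁)).comp_neg).congr
      (Eventually.of_forall fun t => ?_)
    simp only
    congr 1
    push_cast
    ring
  have hGammas := integrable_mul_Gamma_comp (integrable_mul_Gamma_comp hGamma₁
    (g := fun t => a₂ - (c + t * Complex.I)) (by fun_prop) (sub_pos.2 h₂) (by simp))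
    (g := fun t => p + (c + t * Complex.I)) (by fun_prop) (neg_lt_iff_pos_add'.1 hp) (by simp)
  have hw' : (w : ℂ) ≠ 0 := by exact_mod_cast hw.ne'
  simp only [Complex.VerticalIntegrable, meijerIntegrand_two_one]
  refine hGammas.mul_bdd (c := w ^ c)
    (Continuous.const_cpow (by fun_prop) (Or.inl hw')).aestronglyMeasurable
    (Eventually.of_forall fun t => ?_)
  simp [Complex.norm_cpow_eq_rpow_re_of_pos hw]

theorem verticalIntegrable_meijerIntegrand_two_two {w : ℝ} (hw : 0 < w) (hc : 0 < c) (hp : -p < c)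
    (h₁ : c < a₁) (h₂ : c < a₂) : Complex.VerticalIntegrable
      (meijerIntegrand 2 2 ![1, 1 - (p : ℂ)] ![(a₁ : ℂ), (a₂ : ℂ), 0] w) c := by
  have hre (t : ℝ) : (c + t * Complex.I).re = c := by simp
  have hne (t : ℝ) : (c : ℂ) + t * Complex.I ≠ 0 := fun h => by
    have := hre t
    rw [h, Complex.zero_re] at this
    exact hc.ne this
  unfold Complex.VerticalIntegrable
  simp_rw [meijerIntegrand_two_two _ _ _ _ ((hre _).symm ▸ hc)]
  refine (verticalIntegrable_meijerIntegrand_two_one hw hp h₁ h₂).mul_bdd (c := c⁻¹)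
    (Continuous.inv₀ (by fun_prop) hne).aestronglyMeasurable (Eventually.of_forall fun t => ?_)
  rw [norm_inv]
  exact inv_anti₀ hc ((hre t).symm.trans_le (Complex.re_le_norm _))

end meijerGammaGammaInvGamma

/-! ### Products of gamma and inverse gamma variables -/

theorem hasMellin_indicator_Ici {s : ℂ} (hs : s.re < 0) :
    HasMellin (indicator (Ici (1 : ℝ)) fun _ => (1 : ℂ)) s (-s⁻¹) := by
  have hE : (fun t : ℝ => (t : ℂ) ^ (s - 1) • indicator (Ici (1 : ℝ)) (fun _ => (1 : ℂ)) t) =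
      indicator (Ici (1 : ℝ)) fun t : ℝ => (t : ℂ) ^ (s - 1) := by
    funext t
    by_cases ht : t ∈ Ici (1 : ℝ) <;> simp [ht]
  have hsub : Ici (1 : ℝ) ∩ Ioi 0 = Ici 1 :=
    inter_eq_left.2 fun t ht => zero_lt_one.trans_le (mem_Ici.1 ht)
  have hre : (s - 1).re < -1 := by rw [Complex.sub_re, Complex.one_re]; linarith
  constructor
  · rw [MellinConvergent, hE, IntegrableOn, integrable_indicator_iff measurableSet_Ici,
      IntegrableOn, Measure.restrict_restrict measurableSet_Ici, hsub, ← IntegrableOn,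
      integrableOn_Ici_iff_integrableOn_Ioi]
    exact integrableOn_Ioi_cpow_of_lt hre one_pos
  · rw [mellin, hE, integral_indicator measurableSet_Ici,
      Measure.restrict_restrict measurableSet_Ici, hsub, integral_Ici_eq_integral_Ioi,
      integral_Ioi_cpow_of_lt hre one_pos]
    simp [neg_div]

theorem cdf_eq_integral_indicator_Ici_div {ρ : Measure ℝ} [IsProbabilityMeasure ρ]
    (hρ : ∀ᵐ y ∂ρ, 0 < y) (x : ℝ) :
    (cdf ρ x : ℂ) = ∫ y, indicator (Ici (1 : ℝ)) (fun _ => (1 : ℂ)) (x / y) ∂ρ := by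
  have hE : ∫ y, indicator (Ici (1 : ℝ)) (fun _ => (1 : ℂ)) (x / y) ∂ρ =
      ∫ y, indicator (Iic x) (fun _ => (1 : ℂ)) y ∂ρ :=
    integral_congr_ae (hρ.mono fun y hy => by
      simp only [indicator, mem_Ici, mem_Iic, one_le_div hy])
  rw [hE, integral_indicator measurableSet_Iic, cdf_eq_real]
  simp

theorem hasMellin_cdf {ρ : Measure ℝ} [IsProbabilityMeasure ρ] (hρ : ∀ᵐ y ∂ρ, 0 < y) {s d : ℂ}
    (hs : s.re < 0) (h : HasMellinMoment ρ s d) :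
    HasMellin (fun x => (cdf ρ x : ℂ)) s (-s⁻¹ * d) := by
  simp only [cdf_eq_integral_indicator_Ici_div hρ]
  exact hasMellin_integral_comp_div (measurable_const.indicator measurableSet_Ici) hρ
    (hasMellin_indicator_Ici hs) h

theorem continuousAt_cdf {ρ : Measure ℝ} [IsProbabilityMeasure ρ] {x : ℝ} (hx : ρ {x} = 0) :
    ContinuousAt (cdf ρ) x := by
  rw [← measure_cdf ρ, StieltjesFunction.measure_singleton, ENNReal.ofReal_eq_zero,
    sub_nonpos] at hx
  rw [(cdf ρ).mono.continuousAt_iff_leftLim_eq_rightLim, StieltjesFunction.rightLim_eq]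
  exact ((cdf ρ).mono.leftLim_le le_rfl).antisymm hx

/-- The law of `X₀ * X₁ * Y` for independent `X j` with gamma law of shape `m j` and rate `r j`, and
`Y` with inverse gamma law of shape `p` and scale `b`. -/
noncomputable def gammaGammaInvGamma (m r : Fin 2 → ℝ) (p b : ℝ) : Measure ℝ :=
  gammaMeasure (m 0) (r 0) ∗ₘ (gammaMeasure (m 1) (r 1) ∗ₘ invGammaMeasure p b)

/-- The density of `gammaGammaInvGamma`. -/
noncomputable def gammaGammaInvGammaPDF (m r : Fin 2 → ℝ) (p b : ℝ) : ℝ → ℝ :=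
  mconvPDF (gammaPDFReal (m 0) (r 0)) (gammaMeasure (m 1) (r 1) ∗ₘ invGammaMeasure p b)

theorem ae_pos_gamma_mconv_invGamma (a r p b : ℝ) :
    ∀ᵐ y ∂(gammaMeasure a r ∗ₘ invGammaMeasure p b), 0 < y :=
  ae_pos_mconv (ae_pos_gammaMeasure a r) (ae_pos_invGammaMeasure p b)

theorem isProbabilityMeasure_gamma_mconv_invGamma {a r p b : ℝ} (ha : 0 < a) (hr : 0 < r)
    (hp : 0 < p) (hb : 0 < b) :
    IsProbabilityMeasure (gammaMeasure a r ∗ₘ invGammaMeasure p b) := by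
  have := isProbabilityMeasure_gammaMeasure ha hr
  have := isProbabilityMeasure_invGammaMeasure hp hb
  infer_instance

theorem ae_pos_gammaGammaInvGamma (m r : Fin 2 → ℝ) (p b : ℝ) :
    ∀ᵐ y ∂(gammaGammaInvGamma m r p b), 0 < y :=
  ae_pos_mconv (ae_pos_gammaMeasure _ _) (ae_pos_gamma_mconv_invGamma _ _ p b)

theorem measurable_gammaGammaInvGammaPDF (m r : Fin 2 → ℝ) (p b : ℝ) :
    Measurable (gammaGammaInvGammaPDF m r p b) :=
  measurable_mconvPDF (measurable_gammaPDFReal _ _) _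

theorem gammaGammaInvGammaPDF_of_nonpos (m r : Fin 2 → ℝ) (p b : ℝ) {x : ℝ} (hx : x ≤ 0) :
    gammaGammaInvGammaPDF m r p b x = 0 :=
  mconvPDF_of_nonpos (fun _ => gammaPDFReal_of_neg) (ae_pos_gamma_mconv_invGamma _ _ p b) hx

section gammaGammaInvGamma

variable {m r : Fin 2 → ℝ} {p b : ℝ} (hm : ∀ j, 0 < m j) (hr : ∀ j, 0 < r j)

include hm hr

theorem gammaGammaInvGammaPDF_nonneg (p b x : ℝ) : 0 ≤ gammaGammaInvGammaPDF m r p b x :=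
  mconvPDF_nonneg (gammaPDFReal_nonneg (hm 0) (hr 0)) (ae_pos_gamma_mconv_invGamma _ _ p b) x

variable (hp : 0 < p) (hb : 0 < b)

include hp hb

theorem isProbabilityMeasure_gammaGammaInvGamma :
    IsProbabilityMeasure (gammaGammaInvGamma m r p b) := by
  have := isProbabilityMeasure_gammaMeasure (hm 0) (hr 0)
  have := isProbabilityMeasure_gamma_mconv_invGamma (hm 1) (hr 1) hp hb
  unfold gammaGammaInvGamma
  infer_instance

theorem gammaGammaInvGamma_eq_withDensity : gammaGammaInvGamma m r p b =
    volume.withDensity fun x => ENNReal.ofReal (gammaGammaInvGammaPDF m r p b x) := by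
  have := isProbabilityMeasure_gamma_mconv_invGamma (hm 1) (hr 1) hp hb
  exact withDensity_mconv (measurable_gammaPDFReal _ _) (gammaPDFReal_nonneg (hm 0) (hr 0))
    (norm_self_mul_gammaPDFReal_le (hm 0) (hr 0)) (ae_pos_gamma_mconv_invGamma _ _ p b)

theorem hasMellinMoment_neg_gammaGammaInvGamma {s : ℂ} (hsp : -p < s.re) (h₀ : s.re < m 0)
    (h₁ : s.re < m 1) : HasMellinMoment (gammaGammaInvGamma m r p b) (-s)
      (coefS (m 0) (m 1) p * meijerIntegrand 2 1 ![1 - (p : ℂ)] ![(m 0 : ℂ), (m 1 : ℂ)]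
        ((r 0 * r 1 / b : ℝ) : ℂ) s) := by
  have hw : ((r 0 * r 1 / b : ℝ) : ℂ) ^ s = (r 0 : ℂ) ^ s * ((r 1 : ℂ) ^ s * (b : ℂ) ^ (-s)) := by
    rw [mul_div_assoc, Complex.ofReal_mul, Complex.mul_cpow_ofReal_nonneg (hr 0).le
      (div_pos (hr 1) hb).le, div_eq_mul_inv, Complex.ofReal_mul, Complex.mul_cpow_ofReal_nonneg
      (hr 1).le (inv_pos.2 hb).le, Complex.ofReal_inv, Complex.inv_cpow _ _
      (by simpa [Complex.arg_ofReal_of_nonneg hb.le] using Real.pi_pos.ne), Complex.cpow_neg]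
  have hmoment := (hasMellinMoment_gammaMeasure (hm 0) (hr 0) (s := -s) (by simpa using h₀)).mconv
    (ae_pos_gammaMeasure _ _) (ae_pos_gamma_mconv_invGamma _ _ p b)
    ((hasMellinMoment_gammaMeasure (hm 1) (hr 1) (s := -s) (by simpa using h₁)).mconv
      (ae_pos_gammaMeasure _ _) (ae_pos_invGammaMeasure p b)
      (hasMellinMoment_invGammaMeasure hp hb (by simpa using neg_lt.1 hsp)))
  convert! hmoment using 1
  rw [meijerIntegrand_two_one, hw, coefS, neg_neg, sub_neg_eq_add, ← sub_eq_add_neg,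
    ← sub_eq_add_neg]
  push_cast
  simp only [← Complex.Gamma_ofReal, div_eq_mul_inv, mul_inv]
  ring

theorem gammaGammaInvGammaPDF_eq_meijerG {x : ℝ} (hx : 0 < x) :
    (gammaGammaInvGammaPDF m r p b x : ℂ) =
      coefS (m 0) (m 1) p / x *
        meijerG 2 1 ![1 - (p : ℂ)] ![(m 0 : ℂ), (m 1 : ℂ)] ((r 0 * r 1 / b * x : ℝ) : ℂ) := by
  have := isProbabilityMeasure_gamma_mconv_invGamma (hm 1) (hr 1) hp hb
  have hw : 0 < r 0 * r 1 / b := div_pos (mul_pos (hr 0) (hr 1)) hb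
  have hinv : ((x * gammaGammaInvGammaPDF m r p b x : ℝ) : ℂ) = coefS (m 0) (m 1) p *
      meijerG 2 1 ![1 - (p : ℂ)] ![(m 0 : ℂ), (m 1 : ℂ)] ((r 0 * r 1 / b * x : ℝ) : ℂ) := by
    refine eq_meijerG_of_hasMellin (g := fun x => ((x * gammaGammaInvGammaPDF m r p b x : ℝ) : ℂ))
      hw.le hx ⟨0, meijerSeparates_two_one_iff.2 ⟨neg_lt_zero.2 hp, hm 0, hm 1⟩⟩ ?_ ?_ ?_
    · intro s hs
      obtain ⟨hsp, h₀, h₁⟩ := meijerSeparates_two_one_iff.1 hs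
      have hmoment := hasMellinMoment_neg_gammaGammaInvGamma hm hr hp hb hsp h₀ h₁
      rw [gammaGammaInvGamma_eq_withDensity hm hr hp hb] at hmoment
      exact (hasMellinMoment_withDensity_iff (measurable_gammaGammaInvGammaPDF m r p b)
        (gammaGammaInvGammaPDF_nonneg hm hr p b)
        fun y hy => gammaGammaInvGammaPDF_of_nonpos m r p b hy.le).1 hmoment
    · intro c hc
      obtain ⟨hcp, h₀, h₁⟩ := meijerSeparates_two_one_iff.1 hc
      exact verticalIntegrable_meijerIntegrand_two_one hw hcp h₀ h₁
    · exact Complex.continuous_ofReal.continuousAt.comp (continuousAt_self_mul_mconvPDF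
        (measurable_gammaPDFReal _ _) (fun _ => continuousAt_self_mul_gammaPDFReal _ _)
        (norm_self_mul_gammaPDFReal_le (hm 0) (hr 0))
        (ae_pos_gamma_mconv_invGamma _ _ p b) hx)
  have hx' : (x : ℂ) ≠ 0 := by exact_mod_cast hx.ne'
  rw [div_mul_eq_mul_div, ← hinv, Complex.ofReal_mul, mul_div_cancel_left₀ _ hx']

theorem cdf_gammaGammaInvGamma_eq_meijerG {x : ℝ} (hx : 0 < x) :
    (cdf (gammaGammaInvGamma m r p b) x : ℂ) = coefS (m 0) (m 1) p *
      meijerG 2 2 ![1, 1 - (p : ℂ)] ![(m 0 : ℂ), (m 1 : ℂ), 0]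
        ((r 0 * r 1 / b * x : ℝ) : ℂ) := by
  have := isProbabilityMeasure_gammaGammaInvGamma hm hr hp hb
  have hw : 0 < r 0 * r 1 / b := div_pos (mul_pos (hr 0) (hr 1)) hb
  obtain ⟨c, hc, hcm⟩ := exists_between (lt_min (hm 0) (hm 1))
  obtain ⟨hcm₀, hcm₁⟩ := lt_min_iff.1 hcm
  refine eq_meijerG_of_hasMellin (g := fun x => (cdf (gammaGammaInvGamma m r p b) x : ℂ)) hw.le hx
    ⟨c, meijerSeparates_two_two_iff.2 ⟨hc, (neg_lt_zero.2 hp).trans hc, hcm₀, hcm₁⟩⟩ ?_ ?_ ?_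
  · intro s hs
    obtain ⟨hs0, hsp, h₀, h₁⟩ := meijerSeparates_two_two_iff.1 hs
    convert! hasMellin_cdf (ae_pos_gammaGammaInvGamma m r p b) (s := -s) (by simpa using hs0)
      (hasMellinMoment_neg_gammaGammaInvGamma hm hr hp hb hsp h₀ h₁) using 1
    rw [meijerIntegrand_two_two _ _ _ _ hs0, inv_neg, neg_neg]
    ring
  · intro c hc
    obtain ⟨hc0, hcp, h₀, h₁⟩ := meijerSeparates_two_two_iff.1 hc
    exact verticalIntegrable_meijerIntegrand_two_two hw hc0 hcp h₀ h₁
  · refine Complex.continuous_ofReal.continuousAt.comp (continuousAt_cdf ?_)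
    rw [gammaGammaInvGamma_eq_withDensity hm hr hp hb]
    exact withDensity_absolutelyContinuous _ _ Real.volume_singleton

theorem hasMellinMoment_one_gammaGammaInvGamma (hp1 : 1 < p) :
    HasMellinMoment (gammaGammaInvGamma m r p b) 1
      ((m 0 / r 0 * (m 1 / r 1) * (b * Real.Gamma (p - 1) / Real.Gamma p) : ℝ) : ℂ) := by
  have hmoment := hasMellinMoment_neg_gammaGammaInvGamma hm hr hp hb (s := -1) (by simpa using hp1)
    (by simpa using (neg_lt_zero.2 one_pos).trans (hm 0))
    (by simpa using (neg_lt_zero.2 one_pos).trans (hm 1))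
  have hGamma (j : Fin 2) : Complex.Gamma (m j + 1) = m j * Real.Gamma (m j) := by
    rw [Complex.Gamma_add_one _ (by exact_mod_cast (hm j).ne'), Complex.Gamma_ofReal]
  have hGamma' : Complex.Gamma (p - 1) = Real.Gamma (p - 1) := by
    rw [← Complex.Gamma_ofReal, Complex.ofReal_sub, Complex.ofReal_one]
  have hGamma_ne (j : Fin 2) : (Real.Gamma (m j) : ℂ) ≠ 0 := by
    exact_mod_cast (Real.Gamma_pos_of_pos (hm j)).ne'
  have hr_ne (j : Fin 2) : (r j : ℂ) ≠ 0 := by exact_mod_cast (hr j).ne'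
  have := hGamma_ne 0
  have := hGamma_ne 1
  have := hr_ne 0
  have := hr_ne 1
  convert! hmoment using 1
  · rw [neg_neg]
  · rw [meijerIntegrand_two_one, coefS, sub_neg_eq_add, sub_neg_eq_add, ← sub_eq_add_neg, hGamma,
      hGamma, hGamma', Complex.cpow_neg_one]
    push_cast
    field_simp

theorem integrable_id_gammaGammaInvGamma (hp1 : 1 < p) :
    Integrable (fun x => x) (gammaGammaInvGamma m r p b) := by
  simpa using (hasMellinMoment_one_gammaGammaInvGamma hm hr hp hb hp1).1.re

theorem integral_id_gammaGammaInvGamma (hp1 : 1 < p) :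
    ∫ x, x ∂(gammaGammaInvGamma m r p b) =
      m 0 / r 0 * (m 1 / r 1) * (b * Real.Gamma (p - 1) / Real.Gamma p) := by
  have hmean := (hasMellinMoment_one_gammaGammaInvGamma hm hr hp hb hp1).2
  simp only [Complex.cpow_one] at hmean
  rw [integral_complex_ofReal] at hmean
  exact Complex.ofReal_injective hmean

end gammaGammaInvGamma

/-! ### Mixtures -/

/-- The mixture of the measures `ρ i`, `i ∈ t`, with weights `w i`, which should be nonnegative:
negative weights count as `0`. -/
noncomputable def mixture {ι E : Type*} [MeasurableSpace E] (t : Finset ι) (w : ι → ℝ)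
    (ρ : ι → Measure E) : Measure E :=
  ∑ i ∈ t, ENNReal.ofReal (w i) • ρ i

section mixture

variable {ι E : Type*} [MeasurableSpace E] {t : Finset ι} {w : ι → ℝ} {ρ : ι → Measure E}

theorem mixture_apply (A : Set E) :
    mixture t w ρ A = ∑ i ∈ t, ENNReal.ofReal (w i) * ρ i A := by
  simp [mixture]

theorem withDensity_sum_mul {ν : Measure E} {g : ι → E → ℝ} (hw : ∀ i ∈ t, 0 ≤ w i)
    (hg : ∀ i ∈ t, Measurable (g i)) (hg0 : ∀ i ∈ t, ∀ x, 0 ≤ g i x) :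
    (ν.withDensity fun x => ENNReal.ofReal (∑ i ∈ t, w i * g i x)) =
      mixture t w fun i => ν.withDensity fun x => ENNReal.ofReal (g i x) := by
  ext A hA
  have hE (x : E) : ENNReal.ofReal (∑ i ∈ t, w i * g i x) =
      ∑ i ∈ t, ENNReal.ofReal (w i) * ENNReal.ofReal (g i x) := by
    rw [ENNReal.ofReal_sum_of_nonneg fun i hi => mul_nonneg (hw i hi) (hg0 i hi x)]
    exact Finset.sum_congr rfl fun i hi => ENNReal.ofReal_mul (hw i hi)
  simp only [mixture_apply, withDensity_apply _ hA, hE]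
  rw [lintegral_finsetSum' _ fun i hi => ((hg i hi).ennreal_ofReal.const_mul _).aemeasurable]
  exact Finset.sum_congr rfl fun i hi => lintegral_const_mul _ (hg i hi).ennreal_ofReal

theorem measureReal_mixture (hw : ∀ i ∈ t, 0 ≤ w i) (hρ : ∀ i ∈ t, IsFiniteMeasure (ρ i))
    (A : Set E) : (mixture t w ρ).real A = ∑ i ∈ t, w i * (ρ i).real A := by
  rw [measureReal_def, mixture_apply, ENNReal.toReal_sum fun i hi =>
    have := hρ i hi; ENNReal.mul_ne_top ENNReal.ofReal_ne_top (measure_ne_top _ _)]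
  refine Finset.sum_congr rfl fun i hi => ?_
  rw [ENNReal.toReal_mul, ENNReal.toReal_ofReal (hw i hi), measureReal_def]

theorem integrable_mixture {f : E → ℝ} (hf : ∀ i ∈ t, Integrable f (ρ i)) :
    Integrable f (mixture t w ρ) :=
  integrable_finsetSum_measure.2 fun i hi => (hf i hi).smul_measure ENNReal.ofReal_ne_top

theorem integral_mixture {f : E → ℝ} (hw : ∀ i ∈ t, 0 ≤ w i)
    (hf : ∀ i ∈ t, Integrable f (ρ i)) :
    ∫ x, f x ∂(mixture t w ρ) = ∑ i ∈ t, w i * ∫ x, f x ∂(ρ i) := by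
  rw [mixture, integral_finsetSum_measure fun i hi =>
    (hf i hi).smul_measure ENNReal.ofReal_ne_top]
  refine Finset.sum_congr rfl fun i hi => ?_
  rw [integral_smul_measure, ENNReal.toReal_ofReal (hw i hi), smul_eq_mul]

theorem mconv_mixture [Monoid E] [MeasurableMul₂ E] {τ : Measure E} [SFinite τ]
    [∀ i, SFinite (ρ i)] :
    τ ∗ₘ mixture t w ρ = mixture t w fun i => τ ∗ₘ ρ i := by
  classical
  have hsfinite (t : Finset ι) : SFinite (∑ i ∈ t, ENNReal.ofReal (w i) • ρ i) := by
    rw [← Measure.sum_coe_finset]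
    infer_instance
  unfold mixture
  induction t using Finset.induction_on with
  | empty => simp
  | insert i t hi ih =>
    rw [Finset.sum_insert hi, Finset.sum_insert hi, Measure.mconv_add, ih,
      Measure.mconv_smul_right]

end mixture

/-! ### The maximum of independent inverse gamma variables -/

theorem withDensity_Iic_eq_of_hasDerivAt {G g : ℝ → ℝ} (hg : Integrable g) (hg0 : ∀ x, 0 ≤ g x)
    (hneg : ∀ x ≤ 0, g x = 0) (hG : ∀ x > 0, HasDerivAt G (g x) x)
    (hlim : Tendsto G (𝓝[>] 0) (𝓝 0)) {x : ℝ} (hx : 0 < x) :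
    (volume.withDensity fun y => ENNReal.ofReal (g y)) (Iic x) = ENNReal.ofReal (G x) := by
  have hIoc : ∫ y in Iic x, g y = ∫ y in Ioc 0 x, g y :=
    setIntegral_eq_of_subset_of_forall_sdiff_eq_zero measurableSet_Iic Ioc_subset_Iic_self
      fun y hy => hneg y (not_lt.1 fun hy0 => hy.2 ⟨hy0, hy.1⟩)
  rw [withDensity_apply _ measurableSet_Iic, ← ofReal_integral_eq_lintegral_ofReal
    hg.integrableOn (Eventually.of_forall hg0), hIoc, ← intervalIntegral.integral_of_le hx.le,
    intervalIntegral.integral_eq_sub_of_hasDerivAt_of_tendsto hx (fun y hy => hG y hy.1)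
      hg.intervalIntegrable hlim
      ((hG x hx).continuousAt.tendsto.mono_left nhdsWithin_le_nhds), sub_zero]

/-- The survival function of the Erlang law of shape `n` and rate `1`; its value at `b / y` is the
distribution function at `y` of the inverse gamma law of shape `n` and scale `b`. -/
noncomputable def erlangTail (n : ℕ) (u : ℝ) : ℝ :=
  Real.exp (-u) * ∑ k ∈ Finset.range n, u ^ k / (k ! : ℝ)

theorem erlangTail_nonneg (n : ℕ) {u : ℝ} (hu : 0 ≤ u) : 0 ≤ erlangTail n u := by
  unfold erlangTail
  positivity

theorem hasDerivAt_erlangTail (n : ℕ) (u : ℝ) :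
    HasDerivAt (erlangTail (n + 1)) (-(Real.exp (-u) * (u ^ n / (n ! : ℝ)))) u := by
  have hexp : HasDerivAt (fun u : ℝ => Real.exp (-u)) (-Real.exp (-u)) u := by
    simpa using (hasDerivAt_neg u).exp
  induction n with
  | zero =>
    have hone : erlangTail (0 + 1) = fun u : ℝ => Real.exp (-u) := by
      funext u; simp [erlangTail]
    rw [hone]
    simpa using hexp
  | succ n ih =>
    have hsucc : erlangTail (n + 1 + 1) = fun u : ℝ => erlangTail (n + 1) u +
        Real.exp (-u) * (u ^ (n + 1) / ((n + 1)! : ℝ)) := by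
      funext u
      rw [erlangTail, Finset.sum_range_succ, mul_add, erlangTail]
    rw [hsucc]
    convert! ih.add (hexp.mul ((hasDerivAt_pow (n + 1) u).div_const ((n + 1)! : ℝ))) using 1
    have : (n ! : ℝ) ≠ 0 := by exact_mod_cast n.factorial_ne_zero
    rw [Nat.factorial_succ]
    push_cast
    field_simp
    ring

theorem tendsto_erlangTail (n : ℕ) : Tendsto (erlangTail n) atTop (𝓝 0) := by
  have hsum : Tendsto (fun u : ℝ => ∑ k ∈ Finset.range n, u ^ k * Real.exp (-u) / (k ! : ℝ)) atTop
      (𝓝 (∑ k ∈ Finset.range n, 0 / (k ! : ℝ))) :=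
    tendsto_finsetSum _ fun k _ => (Real.tendsto_pow_mul_exp_neg_atTop_nhds_zero k).div_const _
  simp only [zero_div, Finset.sum_const_zero] at hsum
  refine hsum.congr fun u => ?_
  rw [erlangTail, Finset.mul_sum]
  exact Finset.sum_congr rfl fun k _ => by ring

theorem tendsto_erlangTail_div (n : ℕ) {b : ℝ} (hb : 0 < b) :
    Tendsto (fun y => erlangTail n (b / y)) (𝓝[>] 0) (𝓝 0) :=
  (tendsto_erlangTail n).comp <| by
    change Tendsto (fun y => b / y) _ _
    simpa only [div_eq_mul_inv] using tendsto_inv_nhdsGT_zero.const_mul_atTop hb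

theorem integrable_invGammaPDFReal {p b : ℝ} (hp : 0 < p) (hb : 0 < b) :
    Integrable (invGammaPDFReal p b) := by
  have hone := (isProbabilityMeasure_invGammaMeasure hp hb).measure_univ
  rw [invGammaMeasure, withDensity_apply _ MeasurableSet.univ, Measure.restrict_univ] at hone
  refine ⟨(measurable_invGammaPDFReal p b).aestronglyMeasurable, ?_⟩
  rw [hasFiniteIntegral_iff_ofReal (Eventually.of_forall (invGammaPDFReal_nonneg hp hb)), hone]
  exact ENNReal.one_lt_top

theorem invGammaPDFReal_natCast (p : ℕ) (b : ℝ) {y : ℝ} (hy : 0 < y) :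
    invGammaPDFReal p b y = (b / y) ^ p / (Real.Gamma p * y) * Real.exp (-(b / y)) := by
  rw [invGammaPDFReal, if_pos hy, Real.rpow_natCast, Real.rpow_add_one hy.ne', Real.rpow_natCast,
    div_pow]
  field_simp

theorem hasDerivAt_erlangTail_div {n : ℕ} (hn : n ≠ 0) (b : ℝ) {y : ℝ} (hy : 0 < y) :
    HasDerivAt (fun y => erlangTail n (b / y)) (invGammaPDFReal n b y) y := by
  obtain ⟨k, rfl⟩ := Nat.exists_eq_succ_of_ne_zero hn
  have hdiv : HasDerivAt (fun y : ℝ => b / y) (-(b / y ^ 2)) y := by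
    simpa [div_eq_mul_inv] using (hasDerivAt_inv hy.ne').const_mul b
  have hk : (k ! : ℝ) ≠ 0 := by exact_mod_cast k.factorial_ne_zero
  convert! (hasDerivAt_erlangTail k (b / y)).comp y hdiv using 1
  rw [invGammaPDFReal_natCast _ _ hy, Nat.cast_succ, Real.Gamma_nat_eq_factorial, pow_succ]
  field_simp

theorem invGammaMeasure_Iic {n : ℕ} (hn : n ≠ 0) {b : ℝ} (hb : 0 < b) {x : ℝ} (hx : 0 < x) :
    invGammaMeasure n b (Iic x) = ENNReal.ofReal (erlangTail n (b / x)) :=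
  have hn' : (0 : ℝ) < n := Nat.cast_pos.2 (Nat.pos_of_ne_zero hn)
  withDensity_Iic_eq_of_hasDerivAt (integrable_invGammaPDFReal hn' hb)
    (invGammaPDFReal_nonneg hn' hb) (fun _ => invGammaPDFReal_of_nonpos)
    (fun _ => hasDerivAt_erlangTail_div hn b) (tendsto_erlangTail_div n hb) hx

theorem invGammaMeasure_Iic_of_nonpos (p b : ℝ) {x : ℝ} (hx : x ≤ 0) :
    invGammaMeasure p b (Iic x) = 0 :=
  measure_mono_null (fun _ hy => not_lt.2 (le_trans hy hx)) (ae_iff.1 (ae_pos_invGammaMeasure p b))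

theorem erlangTail_pow (n k : ℕ) (u : ℝ) : erlangTail n u ^ k = Real.exp (-u) ^ k *
    ∑ i ∈ Finset.piAntidiag Finset.univ k, (Nat.multinomial Finset.univ i : ℝ) *
      ∏ j : Fin n, (u ^ (j : ℕ) / ((j : ℕ)! : ℝ)) ^ i j := by
  rw [erlangTail, mul_pow, ← Fin.sum_univ_eq_sum_range (fun j => u ^ j / (j ! : ℝ)),
    Finset.sum_pow_eq_sum_piAntidiag]

section maxInvGamma

variable {α L : ℕ}

theorem pExp_pos (hα : α ≠ 0) (n : Fin α → ℕ) : 0 < (pExp n : ℝ) :=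
  Nat.cast_pos.2 ((Nat.pos_of_ne_zero hα).trans_le (Nat.le_add_right _ _))

theorem one_lt_pExp (hα : 1 < α) (n : Fin α → ℕ) : 1 < (pExp n : ℝ) :=
  Nat.one_lt_cast.2 (hα.trans_le (Nat.le_add_right _ _))

theorem coefB_nonneg (L : ℕ) (n : Fin α → ℕ) : 0 ≤ coefB L n := by
  unfold coefB
  positivity

theorem coefB_mul_pow_pExp (hL : L ≠ 0) {n : Fin α → ℕ} (hn : n ∈ multiIndices α L) (u : ℝ) :
    coefB L n * (L * u) ^ pExp n = L * u ^ α *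
      (Nat.multinomial Finset.univ n * ∏ j : Fin α, (u ^ (j : ℕ) / ((j : ℕ)! : ℝ)) ^ n j) := by
  have hL0 : (L : ℝ) ≠ 0 := Nat.cast_ne_zero.2 hL
  have hfactorial : ∏ j, ((n j)! : ℝ) ≠ 0 :=
    Finset.prod_ne_zero_iff.2 fun j _ => Nat.cast_ne_zero.2 (n j).factorial_ne_zero
  have hmultinomial : (L ! : ℝ) =
      L * ((∏ j, ((n j)! : ℝ)) * (Nat.multinomial Finset.univ n : ℝ)) := by
    have hsum : ∑ j, n j = L - 1 := (Finset.mem_piAntidiag.1 hn).1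
    rw [← Nat.mul_factorial_pred hL, ← hsum, ← Nat.multinomial_spec]
    push_cast
    rfl
  have hprod : ∏ j : Fin α, (u ^ (j : ℕ) / ((j : ℕ)! : ℝ)) ^ n j =
      u ^ (∑ j : Fin α, (j : ℕ) * n j) * ∏ j : Fin α, (1 / (((j : ℕ)! : ℕ) : ℝ)) ^ n j := by
    rw [← Finset.prod_pow_eq_pow_sum, ← Finset.prod_mul_distrib]
    exact Finset.prod_congr rfl fun j _ => by rw [div_eq_mul_one_div, mul_pow, pow_mul]
  have hpow : u ^ pExp n = u ^ α * u ^ (∑ j : Fin α, (j : ℕ) * n j) := pow_add _ _ _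
  rw [coefB, mul_pow, hmultinomial, hprod, hpow]
  field_simp

/-- The weights of the mixture of inverse gamma laws that is the law of the maximum of `L`
independent inverse gamma variables of shape `α`, see `maxInvGamma`. -/
noncomputable def maxWeight (L : ℕ) (n : Fin α → ℕ) : ℝ :=
  coefB L n * Real.Gamma (pExp n) / Real.Gamma α

theorem maxWeight_nonneg (L : ℕ) (n : Fin α → ℕ) : 0 ≤ maxWeight L n :=
  div_nonneg (mul_nonneg (coefB_nonneg L n) (Real.Gamma_nonneg_of_nonneg (Nat.cast_nonneg _)))
    (Real.Gamma_nonneg_of_nonneg (Nat.cast_nonneg _))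

theorem sum_maxWeight_mul_invGammaPDFReal (hα : α ≠ 0) (hL : L ≠ 0) (b : ℝ) {y : ℝ}
    (hy : 0 < y) :
    ∑ n ∈ multiIndices α L, maxWeight L n * invGammaPDFReal (pExp n) (L * b) y =
      L * erlangTail α (b / y) ^ (L - 1) * invGammaPDFReal α b y := by
  have hexp : Real.exp (-(L * (b / y))) = Real.exp (-(b / y)) ^ (L - 1) * Real.exp (-(b / y)) := by
    rw [← pow_succ, Nat.sub_add_cancel (Nat.one_le_iff_ne_zero.2 hL), ← Real.exp_nat_mul, mul_neg]
  rw [erlangTail_pow, invGammaPDFReal_natCast _ _ hy, Finset.mul_sum, Finset.mul_sum,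
    Finset.sum_mul, multiIndices]
  refine Finset.sum_congr rfl fun n hn => ?_
  have hGamma : Real.Gamma (pExp n) ≠ 0 := (Real.Gamma_pos_of_pos (pExp_pos hα n)).ne'
  calc maxWeight L n * invGammaPDFReal (pExp n) (L * b) y
      = coefB L n * (L * (b / y)) ^ pExp n * Real.exp (-(L * (b / y))) / (Real.Gamma α * y) := by
        rw [maxWeight, invGammaPDFReal_natCast _ _ hy, mul_div_assoc (L : ℝ) b y]
        field_simp
    _ = _ := by
        rw [coefB_mul_pow_pExp hL hn, hexp]
        ring

/-- The law of the largest of `L` independent inverse gamma variables with shape `α` and scale `b`,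
see `map_iSup_eq_maxInvGamma`. -/
noncomputable def maxInvGamma (α L : ℕ) (b : ℝ) : Measure ℝ :=
  mixture (multiIndices α L) (maxWeight L) fun n => invGammaMeasure (pExp n) (L * b)

theorem maxInvGamma_Iic (hα : α ≠ 0) (hL : L ≠ 0) {b : ℝ} (hb : 0 < b) {x : ℝ} (hx : 0 < x) :
    maxInvGamma α L b (Iic x) = ENNReal.ofReal (erlangTail α (b / x) ^ L) := by
  have hLb : 0 < (L : ℝ) * b := mul_pos (Nat.cast_pos.2 (Nat.pos_of_ne_zero hL)) hb
  have hnonneg (n : Fin α → ℕ) := invGammaPDFReal_nonneg (pExp_pos hα n) hLb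
  have hdensity : maxInvGamma α L b = volume.withDensity fun x => ENNReal.ofReal
      (∑ n ∈ multiIndices α L, maxWeight L n * invGammaPDFReal (pExp n) (L * b) x) :=
    (withDensity_sum_mul (fun n _ => maxWeight_nonneg L n)
      (fun n _ => measurable_invGammaPDFReal _ _) fun n _ => hnonneg n).symm
  rw [hdensity]
  refine withDensity_Iic_eq_of_hasDerivAt (G := fun y => erlangTail α (b / y) ^ L)
    ?_ ?_ ?_ ?_ ?_ hx
  · exact integrable_finsetSum _ fun n _ =>
      (integrable_invGammaPDFReal (pExp_pos hα n) hLb).const_mul _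
  · exact fun y => Finset.sum_nonneg fun n _ => mul_nonneg (maxWeight_nonneg L n) (hnonneg n y)
  · exact fun y hy => Finset.sum_eq_zero fun n _ => by
      rw [invGammaPDFReal_of_nonpos hy, mul_zero]
  · intro y hy
    rw [sum_maxWeight_mul_invGammaPDFReal hα hL b hy]
    exact (hasDerivAt_erlangTail_div hα b hy).pow L
  · simpa [hL] using (tendsto_erlangTail_div α hb).pow L

theorem maxInvGamma_Iic_of_nonpos (α L : ℕ) (b : ℝ) {x : ℝ} (hx : x ≤ 0) :
    maxInvGamma α L b (Iic x) = 0 := by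
  simp [maxInvGamma, mixture_apply, invGammaMeasure_Iic_of_nonpos _ _ hx]

theorem map_iSup_Iic {ι S : Type*} [Fintype ι] [Nonempty ι] [MeasurableSpace S] {μ : Measure S}
    {X : ι → S → ℝ} {τ : Measure ℝ} (hX : ∀ i, Measurable (X i)) (hlaw : ∀ i, HasLaw (X i) τ μ)
    (hindep : iIndepFun X μ) (x : ℝ) :
    μ.map (fun ω => ⨆ i, X i ω) (Iic x) = τ (Iic x) ^ Fintype.card ι := by
  have hset : (fun ω => ⨆ i, X i ω) ⁻¹' Iic x = ⋂ i, X i ⁻¹' Iic x := by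
    ext ω
    simp only [mem_preimage, mem_Iic, mem_iInter]
    exact ciSup_le_iff (finite_range _).bddAbove
  have hmarginal (i : ι) : μ (X i ⁻¹' Iic x) = τ (Iic x) := by
    rw [← (hlaw i).map_eq, Measure.map_apply (hX i) measurableSet_Iic]
  rw [Measure.map_apply (Measurable.iSup hX) measurableSet_Iic, hset,
    hindep.meas_iInter fun i => ⟨_, measurableSet_Iic, rfl⟩]
  simp only [hmarginal, Finset.prod_const, Finset.card_univ]

theorem map_iSup_eq_maxInvGamma {S : Type*} [MeasurableSpace S] {μ : Measure S}
    [IsProbabilityMeasure μ] (hα : α ≠ 0) (hL : L ≠ 0) {b : ℝ} (hb : 0 < b)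
    {I : Fin L → S → ℝ} (hImeas : ∀ i, Measurable (I i))
    (hI : ∀ i, HasLaw (I i) (invGammaMeasure α b) μ) (hindep : iIndepFun I μ) :
    μ.map (fun ω => ⨆ i, I i ω) = maxInvGamma α L b := by
  have : NeZero L := ⟨hL⟩
  have : IsProbabilityMeasure (μ.map fun ω => ⨆ i, I i ω) :=
    Measure.isProbabilityMeasure_map (Measurable.iSup hImeas).aemeasurable
  refine Measure.ext_of_Iic _ _ fun x => ?_
  rw [map_iSup_Iic hImeas hI hindep, Fintype.card_fin]
  rcases le_or_gt x 0 with hx | hx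
  · rw [invGammaMeasure_Iic_of_nonpos _ _ hx, maxInvGamma_Iic_of_nonpos _ _ _ hx, zero_pow hL]
  · rw [invGammaMeasure_Iic hα hb hx, maxInvGamma_Iic hα hL hb hx,
      ENNReal.ofReal_pow (erlangTail_nonneg α (div_pos hb hx).le)]

end maxInvGamma

/-! ### Selection of a branch -/

section Selection

variable {S : Type*} [MeasurableSpace S] {μ : Measure S}

theorem measure_selected_inter {ι E F : Type*} [Countable ι] [MeasurableSpace ι]
    [MeasurableSingletonClass ι] [MeasurableSpace E] [MeasurableSpace F] {X : ι → S → E}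
    {V : S → F} {ξ : Measure E} (hX : ∀ i, HasLaw (X i) ξ μ) (hV : Measurable V)
    (hindep : ∀ i, IndepFun (X i) V μ) {σ : F → ι} (hσ : Measurable σ) {A : Set E} {B : Set F}
    (hA : MeasurableSet A) (hB : MeasurableSet B) :
    μ ((fun ω => X (σ (V ω)) ω) ⁻¹' A ∩ V ⁻¹' B) = ξ A * μ (V ⁻¹' B) := by
  have hfiber (i : ι) : MeasurableSet (σ ⁻¹' {i}) := hσ (measurableSet_singleton i)
  have hsplit (C : Set S) : μ C = ∑' i, μ (V ⁻¹' (σ ⁻¹' {i}) ∩ C) := by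
    have hsum := tsum_measure_preimage_singleton (μ := μ.restrict C) countable_univ (f := σ ∘ V)
      fun i _ => hV (hfiber i)
    rw [tsum_univ fun i => μ.restrict C (σ ∘ V ⁻¹' {i}), preimage_univ,
      Measure.restrict_apply_univ] at hsum
    exact hsum.symm.trans (tsum_congr fun i => Measure.restrict_apply (hV (hfiber i)))
  have hterm (i : ι) : μ (V ⁻¹' (σ ⁻¹' {i}) ∩ ((fun ω => X (σ (V ω)) ω) ⁻¹' A ∩ V ⁻¹' B)) =
      ξ A * μ (V ⁻¹' (σ ⁻¹' {i}) ∩ V ⁻¹' B) := by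
    have hset : V ⁻¹' (σ ⁻¹' {i}) ∩ ((fun ω => X (σ (V ω)) ω) ⁻¹' A ∩ V ⁻¹' B) =
        X i ⁻¹' A ∩ V ⁻¹' (σ ⁻¹' {i} ∩ B) := by
      ext ω
      simp only [mem_inter_iff, mem_preimage, mem_singleton_iff]
      constructor
      · rintro ⟨rfl, hXA, hVB⟩
        exact ⟨hXA, rfl, hVB⟩
      · rintro ⟨hXA, rfl, hVB⟩
        exact ⟨rfl, hXA, hVB⟩
    rw [hset, (hindep i).measure_inter_preimage_eq_mul _ _ hA ((hfiber i).inter hB),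
      ← preimage_inter, ← (hX i).map_eq, Measure.map_apply_of_aemeasurable (hX i).aemeasurable hA]
  rw [hsplit, hsplit (V ⁻¹' B), ← ENNReal.tsum_mul_left]
  exact tsum_congr hterm

theorem exists_measurable_strict_argmax (ι : Type*) [Finite ι] [Nonempty ι] [MeasurableSpace ι] :
    ∃ σ : (ι → ℝ) → ι, Measurable σ ∧ ∀ v i, (∀ j, j ≠ i → v j < v i) → σ v = i := by
  let A (i : ι) : Set (ι → ℝ) := {v | ∀ j, j ≠ i → v j < v i}
  have hA (i : ι) : MeasurableSet (A i) := by
    simp only [A, ofPred_forall]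
    exact MeasurableSet.iInter fun j => MeasurableSet.iInter fun _ =>
      measurableSet_lt (measurable_pi_apply j) (measurable_pi_apply i)
  obtain ⟨σ, hσ, hσA⟩ := exists_measurable_piecewise A hA (fun i _ => i)
    (fun _ => measurable_const) fun i j hij v hv => absurd (hv.1 j hij.symm) (hv.2 i hij).not_gt
  exact ⟨σ, hσ, fun v i hv => hσA i hv⟩

theorem ae_ne_of_indepFun [IsProbabilityMeasure μ] {X Y : S → ℝ} {ρ τ : Measure ℝ}
    [NullSingletonClass τ] (hX : HasLaw X ρ μ) (hY : HasLaw Y τ μ) (h : IndepFun X Y μ) :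
    ∀ᵐ ω ∂μ, X ω ≠ Y ω := by
  have := hX.isProbabilityMeasure_iff.1 inferInstance
  have := hY.isProbabilityMeasure_iff.1 inferInstance
  have hprod : ∀ᵐ z ∂(ρ.prod τ), z.1 ≠ z.2 := by
    refine (Measure.ae_prod_iff_ae_ae
      (measurableSet_eq_fun measurable_fst measurable_snd).compl).2 ?_
    exact Eventually.of_forall fun x => (measure_eq_zero_iff_ae_notMem.1 (measure_singleton x)).mono
      fun y hy hxy => hy hxy.symm
  have hXY := h.hasLaw_prod hX hY
  rw [← hXY.map_eq] at hprod
  exact ae_of_ae_map hXY.aemeasurable hprod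

theorem ae_injective_of_iIndepFun [IsProbabilityMeasure μ] {ι : Type*} [Countable ι]
    {X : ι → S → ℝ} {τ : Measure ℝ} [NullSingletonClass τ] (hX : ∀ i, HasLaw (X i) τ μ)
    (hindep : iIndepFun X μ) : ∀ᵐ ω ∂μ, Function.Injective fun i => X i ω := by
  have hne : ∀ᵐ ω ∂μ, ∀ i j, i ≠ j → X i ω ≠ X j ω :=
    ae_all_iff.2 fun i => ae_all_iff.2 fun j => eventually_imp_distrib_left.2 fun hij =>
      ae_ne_of_indepFun (hX i) (hX j) (hindep.indepFun hij)
  exact hne.mono fun ω hω i j => not_imp_not.1 (hω i j)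

theorem hasLaw_selected {ι E F : Type*} [Countable ι] [MeasurableSpace ι]
    [MeasurableSingletonClass ι] [MeasurableSpace E] [MeasurableSpace F] [IsProbabilityMeasure μ]
    {X : ι → S → E} {V : S → F} {ξ : Measure E} (hX : ∀ i, HasLaw (X i) ξ μ)
    (hXmeas : ∀ i, Measurable (X i)) (hV : Measurable V) (hindep : ∀ i, IndepFun (X i) V μ)
    {σ : F → ι} (hσ : Measurable σ) : HasLaw (fun ω => X (σ (V ω)) ω) ξ μ := by
  have hmeas : Measurable fun ω => X (σ (V ω)) ω :=
    (measurable_from_prod_countable_right (f := fun z : ι × S => X z.1 z.2) hXmeas).comp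
      ((hσ.comp hV).prodMk measurable_id)
  refine ⟨hmeas.aemeasurable, Measure.ext fun A hA => ?_⟩
  simpa [Measure.map_apply hmeas hA] using
    measure_selected_inter hX hV hindep hσ hA MeasurableSet.univ

theorem indepFun_selected {ι E F : Type*} [Countable ι] [MeasurableSpace ι]
    [MeasurableSingletonClass ι] [MeasurableSpace E] [MeasurableSpace F] [IsProbabilityMeasure μ]
    {X : ι → S → E} {V : S → F} {ξ : Measure E} (hX : ∀ i, HasLaw (X i) ξ μ) (hV : Measurable V)
    (hindep : ∀ i, IndepFun (X i) V μ) {σ : F → ι} (hσ : Measurable σ) :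
    IndepFun (fun ω => X (σ (V ω)) ω) V μ :=
  indepFun_iff_measure_inter_preimage_eq_mul.2 fun A B hA hB => by
    have hmarginal : μ ((fun ω => X (σ (V ω)) ω) ⁻¹' A) = ξ A := by
      simpa using measure_selected_inter hX hV hindep hσ hA MeasurableSet.univ
    rw [measure_selected_inter hX hV hindep hσ hA hB, hmarginal]

theorem hasLaw_selected_mul_iSup {ι : Type*} [Finite ι] [Nonempty ι] [MeasurableSpace ι]
    [MeasurableSingletonClass ι] [IsProbabilityMeasure μ] {X I : ι → S → ℝ} {ξ τ : Measure ℝ}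
    [NullSingletonClass τ] (hX : ∀ i, HasLaw (X i) ξ μ) (hXmeas : ∀ i, Measurable (X i))
    (hI : ∀ i, HasLaw (I i) τ μ) (hImeas : ∀ i, Measurable (I i)) (hIindep : iIndepFun I μ)
    (hXI : ∀ i, IndepFun (X i) (fun ω j => I j ω) μ) {s : S → ι}
    (hs : ∀ ω i, I i ω ≤ I (s ω) ω) :
    HasLaw (fun ω => X (s ω) ω * ⨆ i, I i ω) (ξ ∗ₘ μ.map fun ω => ⨆ i, I i ω) μ := by
  obtain ⟨σ, hσ, hσ_argmax⟩ := exists_measurable_strict_argmax ι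
  have hV : Measurable fun ω j => I j ω := measurable_pi_lambda _ hImeas
  have hM : Measurable fun ω => ⨆ i, I i ω := Measurable.iSup hImeas
  have hsup : Measurable fun v : ι → ℝ => ⨆ i, v i := Measurable.iSup measurable_pi_apply
  have := (hX (Classical.arbitrary ι)).isProbabilityMeasure_iff.1 inferInstance
  have := Measure.isProbabilityMeasure_map (μ := μ) hM.aemeasurable
  have hs_eq : ∀ᵐ ω ∂μ, s ω = σ fun j => I j ω := by
    filter_upwards [ae_injective_of_iIndepFun hI hIindep] with ω hω
    exact (hσ_argmax _ _ fun j hj => (hs ω j).lt_of_ne (hω.ne hj)).symm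
  have hlaw := ((indepFun_selected hX hV hXI hσ).comp measurable_id hsup).hasLaw_fun_mul
    (hasLaw_selected hX hXmeas hV hXI hσ) ⟨hM.aemeasurable, rfl⟩
  exact hlaw.congr (hs_eq.mono fun ω hω => by simp only [hω])

theorem indepFun_pi_of_iIndepFun_sumElim {ι κ E : Type*} [Finite ι] [Finite κ]
    [MeasurableSpace E] {X : ι → S → E} {Y : κ → S → E} (hX : ∀ i, Measurable (X i))
    (hY : ∀ k, Measurable (Y k)) (h : iIndepFun (Sum.elim X Y) μ) :
    IndepFun (fun ω i => X i ω) (fun ω k => Y k ω) μ := by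
  classical
  have := Fintype.ofFinite ι
  have := Fintype.ofFinite κ
  have hdisjoint : Disjoint (Finset.univ.map (Function.Embedding.inl : ι ↪ ι ⊕ κ))
      (Finset.univ.map Function.Embedding.inr) := by
    rw [Finset.disjoint_left]
    simp
  have hindep := h.indepFun_finset _ _ hdisjoint (Sum.rec hX hY)
  have hinl : Measurable fun (v : Finset.univ.map (Function.Embedding.inl : ι ↪ ι ⊕ κ) → E) i =>
      v ⟨Sum.inl i, by simp⟩ := by fun_prop
  have hinr : Measurable fun (v : Finset.univ.map (Function.Embedding.inr : κ ↪ ι ⊕ κ) → E) k =>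
      v ⟨Sum.inr k, by simp⟩ := by fun_prop
  exact hindep.comp hinl hinr

theorem hasLaw_outputSNR_mconv [IsProbabilityMeasure μ] {L : ℕ} [NeZero L]
    {N : Fin L → Fin 2 → S → ℝ} {I : Fin L → S → ℝ} {ρ : Fin 2 → Measure ℝ} {τ : Measure ℝ}
    [NullSingletonClass τ] (hNmeas : ∀ i j, Measurable (N i j)) (hImeas : ∀ i, Measurable (I i))
    (hN : ∀ i j, HasLaw (fun ω => N i j ω ^ 2) (ρ j) μ) (hI : ∀ i, HasLaw (I i) τ μ)
    (hindep : ∀ i, iIndepFun (Sum.elim (N i) I : Fin 2 ⊕ Fin L → S → ℝ) μ)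
    {s : S → Fin L} (hs : ∀ ω i, I i ω ≤ I (s ω) ω) :
    HasLaw (outputSNR N I s) ((ρ 0 ∗ₘ ρ 1) ∗ₘ μ.map fun ω => ⨆ i, I i ω) μ := by
  have := (hN 0 0).isProbabilityMeasure_iff.1 inferInstance
  have := (hN 0 1).isProbabilityMeasure_iff.1 inferInstance
  have hsq : Measurable fun x : ℝ => x ^ 2 := by fun_prop
  have hgain (i : Fin L) : HasLaw (fun ω => N i 0 ω ^ 2 * N i 1 ω ^ 2) (ρ 0 ∗ₘ ρ 1) μ :=
    (((hindep i).indepFun (i := Sum.inl 0) (j := Sum.inl 1) (by simp)).comp hsq hsq).hasLaw_fun_mul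
      (hN i 0) (hN i 1)
  have hprod : Measurable fun v : Fin 2 → ℝ => v 0 ^ 2 * v 1 ^ 2 := by fun_prop
  have hgain_indep (i : Fin L) :
      IndepFun (fun ω => N i 0 ω ^ 2 * N i 1 ω ^ 2) (fun ω j => I j ω) μ :=
    (indepFun_pi_of_iIndepFun_sumElim (hNmeas i) hImeas (hindep i)).comp hprod measurable_id
  have hout : outputSNR N I s = fun ω => N (s ω) 0 ω ^ 2 * N (s ω) 1 ω ^ 2 * ⨆ i, I i ω := by
    funext ω
    rw [outputSNR, mul_pow]
  rw [hout]
  exact hasLaw_selected_mul_iSup (X := fun i ω => N i 0 ω ^ 2 * N i 1 ω ^ 2) hgain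
    (fun i => ((hNmeas i 0).pow_const 2).mul ((hNmeas i 1).pow_const 2)) hI hImeas
    ((hindep 0).precomp (g := Sum.inr) Sum.inr_injective) hgain_indep hs

end Selection

/-! ### The law of the output SNR -/

theorem integrable_id_withDensity_iff {g : ℝ → ℝ} (hg : Measurable g) (hg0 : ∀ x, 0 ≤ g x)
    (hneg : ∀ x ≤ 0, g x = 0) :
    Integrable (fun x => x) (volume.withDensity fun x => ENNReal.ofReal (g x)) ↔
      IntegrableOn (fun x => x * g x) (Ioi 0) := by
  have hsupp : Function.support (fun x => x * g x) ⊆ Ioi 0 := fun x hx =>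
    mem_Ioi.2 <| not_le.1 fun hx0 => hx (by simp only [hneg x hx0, mul_zero])
  rw [integrableOn_iff_integrable_of_support_subset hsupp,
    integrable_withDensity_iff_integrable_smul' hg.ennreal_ofReal (by simp)]
  simp only [ENNReal.toReal_ofReal (hg0 _), smul_eq_mul, mul_comm]

theorem integral_id_withDensity {g : ℝ → ℝ} (hg : Measurable g) (hg0 : ∀ x, 0 ≤ g x)
    (hneg : ∀ x ≤ 0, g x = 0) :
    ∫ x, x ∂(volume.withDensity fun x => ENNReal.ofReal (g x)) = ∫ x in Ioi 0, x * g x := by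
  rw [setIntegral_eq_integral_of_forall_compl_eq_zero fun x hx => by
      rw [hneg x (not_lt.1 hx), mul_zero],
    integral_withDensity_eq_integral_toReal_smul hg.ennreal_ofReal (by simp)]
  simp only [ENNReal.toReal_ofReal (hg0 _), smul_eq_mul, mul_comm]

/-- The law of the output SNR of the selection among `L` branches, when the squared multipath
amplitudes have gamma laws of shape `m j` and rate `r j`, and the shadowing coefficients have
inverse gamma laws of shape `α` and scale `b`. -/
noncomputable def selectedSNRMeasure (m r : Fin 2 → ℝ) (α L : ℕ) (b : ℝ) : Measure ℝ :=
  mixture (multiIndices α L) (maxWeight L) fun n => gammaGammaInvGamma m r (pExp n) (L * b)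

/-- The density of `selectedSNRMeasure`. -/
noncomputable def selectedSNRPDF (m r : Fin 2 → ℝ) (α L : ℕ) (b x : ℝ) : ℝ :=
  ∑ n ∈ multiIndices α L, maxWeight L n * gammaGammaInvGammaPDF m r (pExp n) (L * b) x

theorem coefS_mul_maxWeight (m₁ m₂ : ℝ) {α L : ℕ} (hα : α ≠ 0) (n : Fin α → ℕ) :
    coefS m₁ m₂ (pExp n) * maxWeight L n = coefS m₁ m₂ α * coefB L n := by
  have hGamma : Real.Gamma (pExp n) ≠ 0 := (Real.Gamma_pos_of_pos (pExp_pos hα n)).ne'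
  rw [coefS, maxWeight, coefS]
  field_simp

theorem measurable_selectedSNRPDF (m r : Fin 2 → ℝ) (α L : ℕ) (b : ℝ) :
    Measurable (selectedSNRPDF m r α L b) :=
  Finset.measurable_fun_sum _ fun n _ =>
    (measurable_gammaGammaInvGammaPDF m r (pExp n) (L * b)).const_mul _

theorem selectedSNRPDF_of_nonpos (m r : Fin 2 → ℝ) (α L : ℕ) (b x : ℝ) (hx : x ≤ 0) :
    selectedSNRPDF m r α L b x = 0 :=
  Finset.sum_eq_zero fun n _ => by
    rw [gammaGammaInvGammaPDF_of_nonpos m r (pExp n) (L * b) hx, mul_zero]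

section selectedSNR

variable {m r : Fin 2 → ℝ} {α L : ℕ} {b : ℝ} (hm : ∀ j, 0 < m j) (hr : ∀ j, 0 < r j)

include hm hr

theorem selectedSNRPDF_nonneg (α L : ℕ) (b x : ℝ) : 0 ≤ selectedSNRPDF m r α L b x :=
  Finset.sum_nonneg fun n _ => mul_nonneg (maxWeight_nonneg L n)
    (gammaGammaInvGammaPDF_nonneg hm hr (pExp n) (L * b) x)

variable (hα : α ≠ 0) (hL : L ≠ 0) (hb : 0 < b)

include hα hL hb

theorem selectedSNRMeasure_eq_withDensity : selectedSNRMeasure m r α L b =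
    volume.withDensity fun x => ENNReal.ofReal (selectedSNRPDF m r α L b x) := by
  have hLb : 0 < L * b := by positivity
  unfold selectedSNRMeasure selectedSNRPDF
  rw [withDensity_sum_mul (fun n _ => maxWeight_nonneg L n)
    (fun n _ => measurable_gammaGammaInvGammaPDF m r (pExp n) (L * b))
    fun n _ => gammaGammaInvGammaPDF_nonneg hm hr (pExp n) (L * b)]
  simp only [gammaGammaInvGamma_eq_withDensity hm hr (pExp_pos hα _) hLb]

theorem selectedSNRPDF_eq_meijerG {x : ℝ} (hx : 0 < x) :
    (selectedSNRPDF m r α L b x : ℂ) = coefS (m 0) (m 1) α / x *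
      ∑ n ∈ multiIndices α L, coefB L n * meijerG 2 1 ![1 - (pExp n : ℂ)]
        ![(m 0 : ℂ), (m 1 : ℂ)] ((r 0 * r 1 / (L * b) * x : ℝ) : ℂ) := by
  have hLb : 0 < L * b := by positivity
  rw [selectedSNRPDF, Complex.ofReal_sum, Finset.mul_sum]
  refine Finset.sum_congr rfl fun n _ => ?_
  have hcoef := congrArg Complex.ofReal (coefS_mul_maxWeight (m 0) (m 1) (L := L) hα n)
  push_cast at hcoef
  rw [Complex.ofReal_mul, gammaGammaInvGammaPDF_eq_meijerG hm hr (pExp_pos hα n) hLb hx,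
    Complex.ofReal_natCast]
  generalize meijerG _ _ _ _ _ = G
  linear_combination G / x * hcoef

theorem measureReal_selectedSNRMeasure_Iic_eq_meijerG {x : ℝ} (hx : 0 < x) :
    ((selectedSNRMeasure m r α L b).real (Iic x) : ℂ) = coefS (m 0) (m 1) α *
      ∑ n ∈ multiIndices α L, coefB L n * meijerG 2 2 ![1, 1 - (pExp n : ℂ)]
        ![(m 0 : ℂ), (m 1 : ℂ), 0] ((r 0 * r 1 / (L * b) * x : ℝ) : ℂ) := by
  have hLb : 0 < L * b := by positivity
  have hprob (n : Fin α → ℕ) := isProbabilityMeasure_gammaGammaInvGamma hm hr (pExp_pos hα n) hLb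
  rw [selectedSNRMeasure, measureReal_mixture (fun n _ => maxWeight_nonneg L n) fun n _ =>
    inferInstance, Complex.ofReal_sum, Finset.mul_sum]
  refine Finset.sum_congr rfl fun n _ => ?_
  have hcoef := congrArg Complex.ofReal (coefS_mul_maxWeight (m 0) (m 1) (L := L) hα n)
  push_cast at hcoef
  rw [Complex.ofReal_mul, ← cdf_eq_real,
    cdf_gammaGammaInvGamma_eq_meijerG hm hr (pExp_pos hα n) hLb hx, Complex.ofReal_natCast]
  generalize meijerG _ _ _ _ _ = G
  linear_combination G * hcoef

omit hα in
theorem integrable_id_selectedSNRMeasure (hα : 1 < α) :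
    Integrable (fun x => x) (selectedSNRMeasure m r α L b) := by
  have hLb : 0 < L * b := by positivity
  exact integrable_mixture fun n _ => integrable_id_gammaGammaInvGamma hm hr
    (pExp_pos (zero_lt_one.trans hα).ne' n) hLb (one_lt_pExp hα n)

omit hα in
theorem integral_id_selectedSNRMeasure (hα : 1 < α) :
    ∫ x, x ∂(selectedSNRMeasure m r α L b) =
      m 0 / r 0 * (m 1 / r 1) * (L * b) / Real.Gamma α *
        ∑ n ∈ multiIndices α L, coefB L n * Real.Gamma (pExp n - 1) := by
  have hLb : 0 < L * b := by positivity
  have hp (n : Fin α → ℕ) : 0 < (pExp n : ℝ) := pExp_pos (zero_lt_one.trans hα).ne' n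
  rw [selectedSNRMeasure, integral_mixture (fun n _ => maxWeight_nonneg L n) fun n _ =>
    integrable_id_gammaGammaInvGamma hm hr (hp n) hLb (one_lt_pExp hα n), Finset.mul_sum]
  refine Finset.sum_congr rfl fun n _ => ?_
  have hGamma : Real.Gamma (pExp n) ≠ 0 := (Real.Gamma_pos_of_pos (hp n)).ne'
  rw [integral_id_gammaGammaInvGamma hm hr (hp n) hLb (one_lt_pExp hα n), maxWeight]
  field_simp

omit hα in
theorem integrableOn_mul_selectedSNRPDF (hα : 1 < α) :
    IntegrableOn (fun x => x * selectedSNRPDF m r α L b x) (Ioi 0) := by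
  have hα0 : α ≠ 0 := (zero_lt_one.trans hα).ne'
  rw [← integrable_id_withDensity_iff (measurable_selectedSNRPDF m r α L b)
    (selectedSNRPDF_nonneg hm hr α L b) (selectedSNRPDF_of_nonpos m r α L b),
    ← selectedSNRMeasure_eq_withDensity hm hr hα0 hL hb]
  exact integrable_id_selectedSNRMeasure hm hr hL hb hα

omit hα in
theorem integral_mul_selectedSNRPDF (hα : 1 < α) :
    ∫ x in Ioi 0, x * selectedSNRPDF m r α L b x =
      m 0 / r 0 * (m 1 / r 1) * (L * b) / Real.Gamma α *
        ∑ n ∈ multiIndices α L, coefB L n * Real.Gamma (pExp n - 1) := by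
  have hα0 : α ≠ 0 := (zero_lt_one.trans hα).ne'
  rw [← integral_id_withDensity (measurable_selectedSNRPDF m r α L b)
    (selectedSNRPDF_nonneg hm hr α L b) (selectedSNRPDF_of_nonpos m r α L b),
    ← selectedSNRMeasure_eq_withDensity hm hr hα0 hL hb]
  exact integral_id_selectedSNRMeasure hm hr hL hb hα

omit hm hr in
theorem hasLaw_outputSNR {S : Type*} [MeasurableSpace S] {μ : Measure S} [IsProbabilityMeasure μ]
    {N : Fin L → Fin 2 → S → ℝ} {I : Fin L → S → ℝ}
    (hNmeas : ∀ i j, Measurable (N i j)) (hImeas : ∀ i, Measurable (I i))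
    (hN : ∀ i j, HasLaw (fun ω => N i j ω ^ 2) (gammaMeasure (m j) (r j)) μ)
    (hI : ∀ i, HasLaw (I i) (invGammaMeasure α b) μ)
    (hindep : ∀ i, iIndepFun (Sum.elim (N i) I : Fin 2 ⊕ Fin L → S → ℝ) μ)
    {s : S → Fin L} (hs : ∀ ω i, I i ω ≤ I (s ω) ω) :
    HasLaw (outputSNR N I s) (selectedSNRMeasure m r α L b) μ := by
  have : NeZero L := ⟨hL⟩
  have : NullSingletonClass (invGammaMeasure α b) :=
    ⟨fun _ => withDensity_absolutelyContinuous _ _ Real.volume_singleton⟩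
  have hlaw := hasLaw_outputSNR_mconv hNmeas hImeas hN hI hindep hs
  rw [map_iSup_eq_maxInvGamma hα hL hb hImeas hI
    ((hindep 0).precomp (g := Sum.inr) Sum.inr_injective), maxInvGamma, mconv_mixture] at hlaw
  simpa only [selectedSNRMeasure, gammaGammaInvGamma, Measure.mconv_assoc] using hlaw

end selectedSNR

theorem mainTheorem9
    {S : Type*} [MeasurableSpace S] (μ : Measure S) [IsProbabilityMeasure μ]
    (L : ℕ) (hL : 1 ≤ L) (α : ℕ) (hα : 1 < α)
    (m : Fin 2 → ℝ) (hm : ∀ j, 0 < m j)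
    (Ω : ℝ) (hΩ : 0 < Ω) (β : ℝ) (hβ : 0 < β)
    (N : Fin L → Fin 2 → S → ℝ) (I : Fin L → S → ℝ)
    (hNmeas : ∀ i j, Measurable (N i j)) (hImeas : ∀ i, Measurable (I i))
    (hN : ∀ i j, HasLaw (fun ω => N i j ω ^ 2) (gammaMeasure (m j) (m j / Ω)) μ)
    (hI : ∀ i, HasLaw (I i) (invGammaMeasure α β) μ)
    (hindep : ∀ i, iIndepFun (Sum.elim (N i) I : Fin 2 ⊕ Fin L → S → ℝ) μ)
    (s : S → Fin L) (hsmeas : Measurable s) (hs : ∀ ω i, I i ω ≤ I (s ω) ω)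
    (gbar gtilde : ℝ) (hgbar : gbar = Ω ^ 2 * β) (hgtilde : gtilde = m 0 * m 1 / gbar) :
    (∃ f : ℝ → ℝ, Measurable f ∧ (∀ x, 0 ≤ f x) ∧ (∀ x ≤ 0, f x = 0) ∧
      HasLaw (outputSNR N I s) (volume.withDensity fun x => ENNReal.ofReal (f x)) μ ∧
      (∀ x > 0, (f x : ℂ) = (coefS (m 0) (m 1) α : ℂ) / (x : ℂ) *
        ∑ n ∈ multiIndices α L, (coefB L n : ℂ) *
          meijerG 2 1 ![1 - (pExp n : ℂ)] ![(m 0 : ℂ), (m 1 : ℂ)] ((gtilde * x / L : ℝ) : ℂ)) ∧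
      IntegrableOn (fun x => x * f x) (Set.Ioi 0) ∧
      ∫ x in Set.Ioi (0 : ℝ), x * f x =
        L * gbar / Real.Gamma α *
          ∑ n ∈ multiIndices α L, coefB L n * Real.Gamma ((pExp n : ℝ) - 1)) ∧
    (∀ x > 0, ((μ.real {ω | outputSNR N I s ω ≤ x} : ℝ) : ℂ) =
      (coefS (m 0) (m 1) α : ℂ) *
        ∑ n ∈ multiIndices α L, (coefB L n : ℂ) *
          meijerG 2 2 ![1, 1 - (pExp n : ℂ)] ![(m 0 : ℂ), (m 1 : ℂ), 0]
            ((gtilde * x / L : ℝ) : ℂ)) ∧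
    (Integrable (outputSNR N I s) μ ∧
      ∫ ω, outputSNR N I s ω ∂μ =
        L * gbar / Real.Gamma α *
          ∑ n ∈ multiIndices α L, coefB L n * Real.Gamma ((pExp n : ℝ) - 1)) := by
  have hL0 : L ≠ 0 := Nat.one_le_iff_ne_zero.1 hL
  have hα0 : α ≠ 0 := (zero_lt_one.trans hα).ne'
  have hr (j : Fin 2) : 0 < m j / Ω := div_pos (hm j) hΩ
  have hlaw := hasLaw_outputSNR hα0 hL0 hβ hNmeas hImeas hN hI hindep hs
  have hdensity := selectedSNRMeasure_eq_withDensity hm hr hα0 hL0 hβ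
  have hscale (x : ℝ) : m 0 / Ω * (m 1 / Ω) / (L * β) * x = gtilde * x / L := by
    rw [hgtilde, hgbar]
    field_simp
  have hmean_scale : m 0 / (m 0 / Ω) * (m 1 / (m 1 / Ω)) * (L * β) = L * gbar := by
    rw [hgbar, div_div_cancel₀ (hm 0).ne', div_div_cancel₀ (hm 1).ne']
    ring
  refine ⟨⟨_, measurable_selectedSNRPDF m _ α L β, selectedSNRPDF_nonneg hm hr α L β,
    selectedSNRPDF_of_nonpos m _ α L β, hdensity ▸ hlaw, fun x hx => ?_,
    integrableOn_mul_selectedSNRPDF hm hr hL0 hβ hα, ?_⟩, fun x hx => ?_, ?_, ?_⟩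
  · rw [selectedSNRPDF_eq_meijerG hm hr hα0 hL0 hβ hx, hscale]
  · rw [integral_mul_selectedSNRPDF hm hr hL0 hβ hα, hmean_scale]
  · rw [hlaw.measureReal_eq (p := fun y => y ≤ x) measurableSet_Iic, ← hscale]
    exact measureReal_selectedSNRMeasure_Iic_eq_meijerG hm hr hα0 hL0 hβ hx
  · have hint := integrable_id_selectedSNRMeasure hm hr hL0 hβ hα
    exact (hlaw.map_eq ▸ hint).comp_aemeasurable hlaw.aemeasurable
  · rw [hlaw.integral_eq, integral_id_selectedSNRMeasure hm hr hL0 hβ hα, hmean_scale]
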